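/- Let $K$ be a number field and let $f:\mathbb{A}^2\to\mathbb{A}^2$, $f=(f_1,f_2)$ with $f_1,f_2\in K[x,y]$, be a polynomial map whose extension $f:\mathbb{P}^2\dashrightarrow\mathbb{P}^2$ is dominant. Write $\deg f=\max(\deg f_1,\deg f_2)$ for the degree of this extension; the induced map $f^*$ on the one-dimensional space $\mathrm{NS}(\mathbb{P}^2)_{\mathbb{R}}$ is multiplication by $\deg f$. Let $$\delta_f=\lim_{n\to\infty}\rho\bigl((f^n)^*,\mathrm{NS}(\mathbb{P}^2)_{\mathbb{R}}\bigr)^{1/n}$$ be the dynamical degree of $f$, where $\rho$ is the spectral radius, and assume that $\delta_f>1$. Assume that one of the following is true: (a) $f$ is algebraically stable, i.e. $(f^*)^n=(f^n)^*$ on $\mathrm{NS}(\mathbb{P}^2)_{\mathbb{R}}$ for all $n\ge1$; (b) $\deg f=2$. Let $h$ be the absolute logarithmic Weil height on $\mathbb{P}^2(\overline{\mathbb{Q}})$, and view $\mathbb{A}^2\subset\mathbb{P}^2$ through $(x,y)\mapsto[x:y:1]$. Then there is a finite extension $K'$ of $K$ such that: (1) there are a (nonarchimedean) prime $\mathfrak{p}$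 of $K'$ and a nonempty $\mathfrak{p}$-adic open set $U\subset\mathbb{P}^2(K'_{\mathfrak{p}})$ such that the weak lower canonical height $$\underline{\hat h}_f^\circ(P)=\liminf_{n\to\infty}\frac{h(f^n(P))}{\delta_f^n}\in\mathbb{R}\cup\{\infty\}$$ is strictly positive for every $P\in U\cap\mathbb{A}^2(K')$; (2) there is a Zariski dense subset $S$ of $\mathbb{A}^2$, consisting of points of $\mathbb{A}^2(K')$ whose forward orbits $\{P,f(P),f^2(P),\dots\}$ are pairwise disjoint, such that for every $P\in S$ the limit $\alpha_f(P)=\lim_{n\to\infty}\max\{1,h(f^n(P))\}^{1/n}$ exists and equals $\delta_f$. -/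

import Mathlib

open Filter Topology MvPolynomial NumberField
open scoped LinearAlgebra.Projectivization

universe u

noncomputable section

/-- A polynomial self-map `(x, y) ↦ (f₁(x, y), f₂(x, y))` of the affine plane over `k`. -/
abbrev AffineMorphism (k : Type*) [CommRing k] := Fin 2 → MvPolynomial (Fin 2) k

namespace AffineMorphism

section General

variable {k : Type*} [CommRing k]

/-- The composition `f ∘ g`. -/
def comp (f g : AffineMorphism k) : AffineMorphism k := fun i => bind₁ g (f i)

/-- The `n`-th iterate of `f`, again as a polynomial map. -/
def iterate (f : AffineMorphism k) : ℕ → AffineMorphism k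
  | 0 => fun i => X i
  | n + 1 => comp f (iterate f n)

/-- The degree `d` of `f`, equal to the degree of its extension to `ℙ²`: this extension is
`[X : Y : Z] ↦ [Z ^ d f₁(X/Z, Y/Z) : Z ^ d f₂(X/Z, Y/Z) : Z ^ d]`, and these three forms of
degree `d` have no common factor. -/
def degree (f : AffineMorphism k) : ℕ := max (f 0).totalDegree (f 1).totalDegree

/-- The endomorphism `f^*` of the one-dimensional space `NS(ℙ²)_ℝ = ℝ ⬝ [H]`, where `H` is a line
and the class of a curve is its degree times `[H]`. The pullback of the curve `G = 0` by
`F = [F₁ : F₂ : F₃]` is the curve `G ∘ F = 0`, so that `f^*` multiplies degrees by `deg f`. -/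
def pullbackNS (f : AffineMorphism k) : Module.End ℝ ℝ := (f.degree : ℝ) • LinearMap.id

/-- Algebraic stability: `(f^*)^n = (f^n)^*` on `NS(ℙ²)_ℝ` for all `n ≥ 1`. -/
def AlgebraicallyStable (f : AffineMorphism k) : Prop :=
  ∀ n : ℕ, 1 ≤ n → f.pullbackNS ^ n = (f.iterate n).pullbackNS

/-- The first dynamical degree `δ_f = lim ρ((f^n)^*, NS(ℙ²)_ℝ)^(1/n)`. The limit exists, see
`tendsto_dynamicalDegree`. -/
def dynamicalDegree (f : AffineMorphism k) : ℝ :=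
  limUnder atTop fun n : ℕ => (spectralRadius ℝ (f.iterate n).pullbackNS).toReal ^ (1 / (n : ℝ))

/-- The self-map of `𝔸²(L)` that `f` induces, for an algebra `L` over the field of definition. -/
def onPoints (f : AffineMorphism k) {L : Type*} [CommRing L] [Algebra k L]
    (P : Fin 2 → L) : Fin 2 → L := fun i => aeval P (f i)

/-- The forward orbit `{P, f(P), f²(P), …}`. -/
def orbit (f : AffineMorphism k) {L : Type*} [CommRing L] [Algebra k L]
    (P : Fin 2 → L) : Set (Fin 2 → L) := Set.range fun n : ℕ => f.onPoints^[n] P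

end General

/-- A set of `k`-points of the affine plane is Zariski dense (in `𝔸²`, equivalently in `ℙ²`) if
no nonzero polynomial vanishes on it. -/
def ZariskiDense {k : Type*} [Field k] (S : Set (Fin 2 → k)) : Prop :=
  ∀ g : MvPolynomial (Fin 2) k, (∀ P ∈ S, eval P g = 0) → g = 0

/-- `f` is dominant: the image of the geometric points is Zariski dense. -/
def Dominant {k : Type*} [Field k] (f : AffineMorphism k) : Prop :=
  ZariskiDense (Set.range (f.onPoints (L := AlgebraicClosure k)))

/-- The point `[x : y : 1]` of `ℙ²(L)` given by `(x, y) ∈ 𝔸²(L)`. -/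
def toProj {L : Type*} [Field L] (P : Fin 2 → L) : ℙ L (Fin 3 → L) :=
  Projectivization.mk L ![P 0, P 1, 1] fun h => one_ne_zero (congrFun h 2)

/-- The absolute logarithmic Weil height `h([x : y : 1])` of `(x, y) ∈ 𝔸²(L)`,
for a number field `L`. -/
def height {L : Type*} [Field L] [NumberField L] (P : Fin 2 → L) : ℝ :=
  (toProj P).logHeight / Module.finrank ℚ L

/-- The weak lower canonical height `liminf h(f^n(P)) / δ_f^n`, with values in `ℝ ∪ {±∞}`. -/
def weakLowerCanonicalHeight {k : Type*} [Field k] (f : AffineMorphism k)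
    {L : Type*} [Field L] [NumberField L] [Algebra k L] (P : Fin 2 → L) : EReal :=
  liminf (fun n : ℕ => ((height (f.onPoints^[n] P) / f.dynamicalDegree ^ n : ℝ) : EReal)) atTop

/-- The limit `α_f(P) = lim max(1, h(f^n(P)))^(1/n)` exists and is equal to `a`. -/
def HasArithmeticDegree {k : Type*} [Field k] (f : AffineMorphism k)
    {L : Type*} [Field L] [NumberField L] [Algebra k L] (P : Fin 2 → L) (a : ℝ) : Prop :=
  Tendsto (fun n : ℕ => max 1 (height (f.onPoints^[n] P)) ^ (1 / (n : ℝ))) atTop (𝓝 a)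

end AffineMorphism

/-- The quotient topology on the projectivization of a topological vector space. For
`V = L ^ (N + 1)` over a complete field `L` this is the usual topology of `ℙ^N(L)`. -/
instance projectivizationTopology {L V : Type*} [DivisionRing L] [AddCommGroup V] [Module L V]
    [TopologicalSpace V] : TopologicalSpace (ℙ L V) :=
  TopologicalSpace.coinduced (Projectivization.mk' L) inferInstance

namespace AffineMorphism

section LimitExists

variable {k : Type*} [CommRing k]

theorem spectralRadius_pullbackNS (f : AffineMorphism k) :
    (spectralRadius ℝ f.pullbackNS).toReal = f.degree := by
  have h : f.pullbackNS = algebraMap ℝ (Module.End ℝ ℝ) (f.degree : ℝ) := by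
    rw [Algebra.algebraMap_eq_smul_one]; rfl
  rw [h, spectralRadius, spectrum.scalar_eq]
  simp

theorem totalDegree_le_degree (f : AffineMorphism k) (i : Fin 2) :
    (f i).totalDegree ≤ f.degree := by
  fin_cases i <;> simp [degree]

theorem totalDegree_bind₁_le (g : AffineMorphism k) (p : MvPolynomial (Fin 2) k) :
    (bind₁ g p).totalDegree ≤ p.totalDegree * g.degree := by
  conv_lhs => rw [p.as_sum, map_sum]
  refine (totalDegree_finsetSum_le fun s hs => ?_)
  rw [bind₁_monomial]
  refine (totalDegree_mul _ _).trans ?_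
  rw [totalDegree_C, zero_add]
  refine (totalDegree_finsetProd _ _).trans ?_
  calc ∑ i ∈ s.support, (g i ^ s i).totalDegree
      ≤ ∑ i ∈ s.support, s i * g.degree := Finset.sum_le_sum fun i _ =>
        (totalDegree_pow _ _).trans (Nat.mul_le_mul_left _ (totalDegree_le_degree g i))
    _ = (s.sum fun _ e => e) * g.degree := by rw [Finsupp.sum, Finset.sum_mul]
    _ ≤ p.totalDegree * g.degree := Nat.mul_le_mul_right _ (le_totalDegree hs)

theorem degree_comp_le (f g : AffineMorphism k) : (comp f g).degree ≤ f.degree * g.degree :=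
  max_le
    ((totalDegree_bind₁_le g (f 0)).trans
      (Nat.mul_le_mul_right _ (totalDegree_le_degree f 0)))
    ((totalDegree_bind₁_le g (f 1)).trans
      (Nat.mul_le_mul_right _ (totalDegree_le_degree f 1)))

theorem iterate_add (f : AffineMorphism k) (m n : ℕ) :
    f.iterate (m + n) = comp (f.iterate m) (f.iterate n) := by
  induction m with
  | zero => ext1 i; simp [iterate, comp]
  | succ m ih =>
    rw [Nat.add_right_comm]
    ext1 i
    simp only [iterate, ih, comp]
    rw [bind₁_bind₁]; rfl

/-- The limit that defines the dynamical degree exists. -/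
theorem tendsto_dynamicalDegree (f : AffineMorphism k) :
    Tendsto (fun n : ℕ => (spectralRadius ℝ (f.iterate n).pullbackNS).toReal ^ (1 / (n : ℝ)))
      atTop (𝓝 f.dynamicalDegree) := by
  refine tendsto_nhds_limUnder ?_
  simp only [spectralRadius_pullbackNS]
  by_cases h : ∃ m, (f.iterate m).degree = 0
  · obtain ⟨m, hm⟩ := h
    refine ⟨0, tendsto_const_nhds.congr' ?_⟩
    filter_upwards [eventually_ge_atTop (m + 1)] with n hn
    have h0 : (f.iterate n).degree = 0 := by
      have := degree_comp_le (f.iterate (n - m)) (f.iterate m)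
      rw [← iterate_add, Nat.sub_add_cancel (by omega), hm, mul_zero] at this
      omega
    have hn0 : (1 / (n : ℝ)) ≠ 0 := by
      have : (n : ℝ) ≠ 0 := by exact_mod_cast (by omega : n ≠ 0)
      positivity
    rw [h0, Nat.cast_zero, Real.zero_rpow hn0]
  · push Not at h
    have hpos : ∀ n, (1 : ℝ) ≤ (f.iterate n).degree := fun n => by
      exact_mod_cast Nat.one_le_iff_ne_zero.mpr (h n)
    have hsub : Subadditive fun n => Real.log (f.iterate n).degree := fun m n => by
      rw [← Real.log_mul (by linarith [hpos m]) (by linarith [hpos n])]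
      refine Real.log_le_log (by linarith [hpos (m + n)]) ?_
      rw [iterate_add]
      exact_mod_cast degree_comp_le _ _
    have hbdd : BddBelow (Set.range fun n : ℕ => Real.log (f.iterate n).degree / n) :=
      ⟨0, by
        rintro _ ⟨n, rfl⟩
        exact div_nonneg (Real.log_nonneg (hpos n)) (Nat.cast_nonneg n)⟩
    refine ⟨Real.exp hsub.lim, ((Real.continuous_exp.tendsto _).comp
      (hsub.tendsto_lim hbdd)).congr fun n => ?_⟩
    rw [Function.comp_apply, Real.rpow_def_of_pos (by linarith [hpos n]), mul_one_div]

end LimitExists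

end AffineMorphism

end

/-! Fix a prime `p` and look at points that are `p`-adically close to the line at infinity. Suppose
that `f` preserves a set of such points on which the logarithm of the `p`-adic size of a coordinate
grows at least like a constant times `δ ^ n`. One local term then bounds the height from below,
which makes the weak lower canonical height positive; functoriality of heights gives the matching
upper bound for the arithmetic degree (`height_iterate_le`). The orbits are disjoint because the
pole orders at `p` evolve under an injective linear map, and the starting points are given pole
orders that this map never produces. `exists_of_invariant_region` packages this, so the task is to
find the region.

Let `d = deg f`. The forms of degree `d` in the two components describe `f` along the line at
infinity.

If these forms are linearly independent, then modulo a good prime they are `A * D` and `B * D` with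
`A`, `B` coprime and `A / B` nonconstant. For a large power `Q` of the order of the residue field,
the equation `(A / B)(ξ) ^ Q = ξ` has at least `Q` distinct geometric solutions, so one of them
avoids the zeros of `D`. There `A / B` acts as an inverse power of Frobenius, and since `D` is
defined over the residue field the whole orbit avoids its zeros. In the residue classes of such
points, lifted to an extension `L`, the size of a coordinate is raised to the power `d ≥ δ`
(`exists_hasLargeOrbitsOver_of_coeff_ne_zero`).

If the forms are proportional, the line at infinity is contracted to a point. If `f` is defined
there, the residue class of this point is preserved and the same region works over `K`. Otherwise
`deg (f ∘ f) < d ^ 2` (`degree_comp_self_lt`), which contradicts algebraic stability. There remains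
`d = 2`: in sheared coordinates `f` is `(x, t) ↦ (t (α x + β t) + …, ρ x + …)`, and near infinity it
acts on absolute values like `(x t, x)` or `(t ^ 2, x)` (`mem_shearRegion_of_form`). The growth
rates, the golden ratio and `√2`, also bound `δ` from above (`dynamicalDegree_le_of_shear_form`). -/

noncomputable section

namespace AffineMorphism

/-! ### Action on points, homogenization and Weil heights -/

section Points

variable {k : Type*} [CommRing k] {L : Type*} [CommRing L] [Algebra k L]

theorem onPoints_comp (f g : AffineMorphism k) (P : Fin 2 → L) :
    (comp f g).onPoints P = f.onPoints (g.onPoints P) := by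
  ext i
  simp only [onPoints, comp, aeval_bind₁]
  rfl

theorem onPoints_iterate (f : AffineMorphism k) (n : ℕ) (P : Fin 2 → L) :
    (f.iterate n).onPoints P = f.onPoints^[n] P := by
  induction n with
  | zero => ext i; simp [onPoints, iterate]
  | succ n ih =>
    rw [Function.iterate_succ_apply', ← ih, iterate, onPoints_comp]

end Points

section Homogenization

variable {L : Type*} [CommRing L]

/-- The homogenization of degree `N` of a polynomial in two variables. -/
def homogenization (N : ℕ) (g : MvPolynomial (Fin 2) L) : MvPolynomial (Fin 3) L :=
  ∑ s ∈ g.support, C (g.coeff s) * (X 0 ^ s 0 * X 1 ^ s 1 * X 2 ^ (N - (s 0 + s 1)))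

theorem le_of_mem_support {σ : Type*} [CommSemiring σ] {g : MvPolynomial (Fin 2) σ} {N : ℕ}
    (hg : g.totalDegree ≤ N) {s : Fin 2 →₀ ℕ} (hs : s ∈ g.support) : s 0 + s 1 ≤ N := by
  have h := le_totalDegree hs
  rw [Finsupp.sum_fintype _ _ fun _ => rfl, Fin.sum_univ_two] at h
  exact h.trans hg

theorem isHomogeneous_homogenization {N : ℕ} {g : MvPolynomial (Fin 2) L}
    (hg : g.totalDegree ≤ N) : (homogenization N g).IsHomogeneous N := by
  refine IsHomogeneous.sum _ _ _ fun s hs => ?_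
  have h := le_of_mem_support hg hs
  have := (isHomogeneous_C (Fin 3) (g.coeff s)).mul
    (((isHomogeneous_X_pow (R := L) (0 : Fin 3) (s 0)).mul (isHomogeneous_X_pow 1 (s 1))).mul
      (isHomogeneous_X_pow 2 (N - (s 0 + s 1))))
  convert this using 1
  omega

theorem eval_homogenization (N : ℕ) (g : MvPolynomial (Fin 2) L) (P : Fin 2 → L) :
    eval ![P 0, P 1, 1] (homogenization N g) = eval P g := by
  rw [eval_eq' P g]
  simp [homogenization]

end Homogenization

section Heights

variable {L : Type*} [Field L] [NumberField L]

theorem height_eq (P : Fin 2 → L) :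
    height P = Height.logHeight ![P 0, P 1, 1] / Module.finrank ℚ L := rfl

theorem height_nonneg (P : Fin 2 → L) : 0 ≤ height P :=
  div_nonneg (Projectivization.logHeight_nonneg _) (Nat.cast_nonneg _)

theorem finrank_pos_real : (0 : ℝ) < Module.finrank ℚ L := by
  exact_mod_cast Module.finrank_pos

theorem log_adicAbv_le_logHeight₁ (p : IsDedekindDomain.HeightOneSpectrum (𝓞 L)) (x : L) :
    Real.log (NumberField.HeightOneSpectrum.adicAbv L p x) ≤ Height.logHeight₁ x := by
  rw [NumberField.logHeight₁_eq]
  have h1 : 0 ≤ ∑ v : InfinitePlace L, v.mult * Real.posLog (v x) :=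
    Finset.sum_nonneg fun v _ => mul_nonneg (Nat.cast_nonneg _) Real.posLog_nonneg
  rcases eq_or_ne x 0 with rfl | hx
  · simp
  have hfin : (Function.HasFiniteSupport fun v : FinitePlace L => Real.posLog (v x)) := by
    refine (FinitePlace.hasFiniteMulSupport hx).subset fun v hv => ?_
    simp only [Function.mem_support, Function.mem_mulSupport] at hv ⊢
    intro h1
    exact hv (by rw [h1, Real.posLog_one])
  have h2 := single_le_finsum (FinitePlace.mk p) hfin fun v => Real.posLog_nonneg
  rw [FinitePlace.mk_apply, FinitePlace.norm_embedding] at h2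
  have h3 : Real.log (NumberField.HeightOneSpectrum.adicAbv L p x) ≤
      Real.posLog (NumberField.HeightOneSpectrum.adicAbv L p x) := le_max_right _ _
  linarith

/-- Dropping a coordinate of `[x : y : 1]` does not increase the height, and the height of a number
is a sum of nonnegative local terms, one of which belongs to `p`. -/
theorem log_adicAbv_le_height (p : IsDedekindDomain.HeightOneSpectrum (𝓞 L)) (P : Fin 2 → L)
    (i : Fin 2) :
    Real.log (NumberField.HeightOneSpectrum.adicAbv L p (P i)) / Module.finrank ℚ L ≤ height P := by
  rw [height_eq]
  refine div_le_div_of_nonneg_right ?_ (Nat.cast_nonneg _)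
  refine (log_adicAbv_le_logHeight₁ p (P i)).trans ?_
  rw [Height.logHeight₁_eq_logHeight]
  have := Height.logHeight_comp_le ![i.castSucc, (2 : Fin 3)] ![P 0, P 1, 1]
  have e : ![P i, 1] = ![P 0, P 1, 1] ∘ ![i.castSucc, (2 : Fin 3)] := by
    funext j
    fin_cases j
    · fin_cases i <;> rfl
    · rfl
  rw [e]
  exact this

/-- The extension to the projective plane is given by three forms of degree `deg g`; the upper bound
for heights does not need these to be free of common zeros. -/
theorem height_onPoints_le {k : Type*} [CommRing k] [Algebra k L] (g : AffineMorphism k) :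
    ∃ C, 0 ≤ C ∧ ∀ P : Fin 2 → L, height (g.onPoints P) ≤ g.degree * height P + C := by
  have hdeg : ∀ i, (map (algebraMap k L) (g i)).totalDegree ≤ g.degree := fun i =>
    (Finset.sup_mono (support_map_subset _ _)).trans (totalDegree_le_degree g i)
  set F : Fin 3 → MvPolynomial (Fin 3) L :=
    ![homogenization g.degree (map (algebraMap k L) (g 0)),
      homogenization g.degree (map (algebraMap k L) (g 1)), X 2 ^ g.degree] with hF
  have hhom : ∀ i, (F i).IsHomogeneous g.degree := by
    intro i
    fin_cases i
    · exact isHomogeneous_homogenization (hdeg 0)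
    · exact isHomogeneous_homogenization (hdeg 1)
    · exact isHomogeneous_X_pow _ _
  obtain ⟨C, hC⟩ := Height.logHeight_eval_le' hhom
  refine ⟨max C 0 / Module.finrank ℚ L, div_nonneg (le_max_right _ _) (Nat.cast_nonneg _),
    fun P => ?_⟩
  rw [height_eq, height_eq, ← mul_div_assoc, ← add_div]
  refine div_le_div_of_nonneg_right ?_ (Nat.cast_nonneg _)
  have h := hC ![P 0, P 1, 1]
  have he : (fun j => eval ![P 0, P 1, 1] (F j)) = ![g.onPoints P 0, g.onPoints P 1, 1] := by
    ext j
    fin_cases j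
    · simp [hF, eval_homogenization, onPoints, aeval_def, eval_map]
    · simp [hF, eval_homogenization, onPoints, aeval_def, eval_map]
    · simp [hF]
  rw [he] at h
  linarith [le_max_left C 0]

end Heights

/-! ### Dynamical degrees and arithmetic degrees -/

section DynamicalDegree

variable {k : Type*} [CommRing k]

theorem tendsto_degree_iterate (f : AffineMorphism k) :
    Tendsto (fun n : ℕ => ((f.iterate n).degree : ℝ) ^ (1 / (n : ℝ))) atTop
      (𝓝 f.dynamicalDegree) := by
  simpa only [spectralRadius_pullbackNS] using tendsto_dynamicalDegree f

theorem degree_iterate_le (f : AffineMorphism k) (n : ℕ) :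
    (f.iterate (n + 1)).degree ≤ f.degree ^ (n + 1) := by
  induction n with
  | zero => simp [iterate, comp, degree]
  | succ n ih =>
    rw [iterate, pow_succ']
    exact (degree_comp_le _ _).trans (Nat.mul_le_mul_left _ ih)

/-- A geometric bound for the degrees of the iterates bounds the dynamical degree. -/
theorem dynamicalDegree_le_of_degree_le (f : AffineMorphism k) {A r : ℝ} (hA : 0 < A) (hr : 0 < r)
    (h : ∀ n : ℕ, ((f.iterate (n + 1)).degree : ℝ) ≤ A * r ^ (n + 1)) : f.dynamicalDegree ≤ r := by
  have h1 : Tendsto (fun n : ℕ => A ^ (1 / (n : ℝ)) * r) atTop (𝓝 (A ^ (0 : ℝ) * r)) :=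
    (((Real.continuous_const_rpow hA.ne').tendsto 0).comp tendsto_one_div_atTop_nhds_zero_nat
      ).mul_const r
  rw [Real.rpow_zero, one_mul] at h1
  refine le_of_tendsto_of_tendsto (tendsto_degree_iterate f) h1 ?_
  filter_upwards [eventually_ge_atTop 1] with n hn
  obtain ⟨m, rfl⟩ : ∃ m, n = m + 1 := ⟨n - 1, by omega⟩
  have hm : ((m + 1 : ℕ) : ℝ) ≠ 0 := by positivity
  calc ((f.iterate (m + 1)).degree : ℝ) ^ (1 / ((m + 1 : ℕ) : ℝ))
      ≤ (A * r ^ (m + 1)) ^ (1 / ((m + 1 : ℕ) : ℝ)) :=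
        Real.rpow_le_rpow (Nat.cast_nonneg _) (h m) (by positivity)
    _ = A ^ (1 / ((m + 1 : ℕ) : ℝ)) * r := by
        rw [Real.mul_rpow hA.le (by positivity), one_div,
          Real.pow_rpow_inv_natCast hr.le (by omega)]

theorem dynamicalDegree_le_degree (f : AffineMorphism k) (hf : 0 < f.degree) :
    f.dynamicalDegree ≤ f.degree :=
  dynamicalDegree_le_of_degree_le f one_pos (by exact_mod_cast hf) fun n => by
    rw [one_mul]; exact_mod_cast degree_iterate_le f n

end DynamicalDegree

section ArithmeticDegree

variable {k : Type*} [Field k] {L : Type*} [Field L] [NumberField L] [Algebra k L]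

/-- Some iterate `f ^ m` has degree at most `r ^ m`, so the height bound for this one iterate can be
propagated in steps of length `m`. -/
theorem height_iterate_le (f : AffineMorphism k) {r : ℝ} (hr1 : 1 < r)
    (hr : f.dynamicalDegree < r) (P : Fin 2 → L) :
    ∃ A, 0 < A ∧ ∀ n, max 1 (height (f.onPoints^[n] P)) ≤ A * r ^ n := by
  obtain ⟨m, hm1, hmr, hm2⟩ : ∃ m : ℕ, 1 ≤ m ∧ ((f.iterate m).degree : ℝ) ≤ r ^ m ∧
      2 ≤ r ^ m := by
    have h1 := (tendsto_degree_iterate f).eventually_lt_const hr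
    have h2 := (tendsto_pow_atTop_atTop_of_one_lt hr1).eventually_ge_atTop 2
    obtain ⟨m, ⟨ha, hb⟩, hc⟩ := ((h1.and h2).and (eventually_ge_atTop 1)).exists
    refine ⟨m, hc, ?_, hb⟩
    have := pow_le_pow_left₀ (by positivity) ha.le m
    rwa [one_div, Real.rpow_inv_natCast_pow (Nat.cast_nonneg _) (by omega)] at this
  obtain ⟨C, hC0, hC⟩ := height_onPoints_le (L := L) (f.iterate m)
  set E : ℕ → ℝ := fun n => max 1 (height (f.onPoints^[n] P)) with hE
  have hE1 : ∀ n, 1 ≤ E n := fun n => le_max_left _ _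
  -- Adding `C` to both sides absorbs the error term, because `2 * C ≤ r ^ m * C`.
  have hstep : ∀ n, E (n + m) + C ≤ r ^ m * (E n + C) := by
    intro n
    have h := hC (f.onPoints^[n] P)
    rw [onPoints_iterate, ← Function.iterate_add_apply, add_comm m n] at h
    have h3 : ((f.iterate m).degree : ℝ) * height (f.onPoints^[n] P) ≤ r ^ m * E n :=
      mul_le_mul hmr (le_max_right _ _) (height_nonneg _) (by positivity)
    have h4 : 1 ≤ r ^ m * E n := by nlinarith [hE1 n]
    have h5 : C * 2 ≤ C * r ^ m := mul_le_mul_of_nonneg_left hm2 hC0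
    have h6 : E (n + m) ≤ r ^ m * E n + C := max_le (by linarith) (by linarith)
    linarith
  have hA : ∃ A, 0 < A ∧ ∀ n < m, E n + C ≤ A := by
    refine ⟨∑ n ∈ Finset.range m, (E n + C), ?_, fun n hn => ?_⟩
    · exact Finset.sum_pos (fun n _ => by linarith [hE1 n]) ⟨0, Finset.mem_range.mpr hm1⟩
    · exact Finset.single_le_sum (f := fun n => E n + C) (fun i _ => by linarith [hE1 i])
        (Finset.mem_range.mpr hn)
  obtain ⟨A, hA0, hA⟩ := hA
  have key : ∀ n, E n + C ≤ A * r ^ n := by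
    intro n
    induction n using Nat.strong_induction_on with
    | _ n ih =>
      by_cases hn : n < m
      · exact (hA n hn).trans (le_mul_of_one_le_right hA0.le (one_le_pow₀ hr1.le))
      · obtain ⟨j, rfl⟩ : ∃ j, n = j + m := ⟨n - m, by omega⟩
        refine (hstep j).trans ?_
        have := mul_le_mul_of_nonneg_left (ih j (by omega)) (by positivity : 0 ≤ r ^ m)
        calc r ^ m * (E j + C) ≤ r ^ m * (A * r ^ j) := this
          _ = A * r ^ (j + m) := by ring
  exact ⟨A, hA0, fun n => by linarith [key n]⟩

theorem tendsto_const_mul_pow_root {c r : ℝ} (hc : 0 < c) (hr : 0 ≤ r) :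
    Tendsto (fun n : ℕ => (c * r ^ n) ^ (1 / (n : ℝ))) atTop (𝓝 r) := by
  have h1 : Tendsto (fun n : ℕ => c ^ (1 / (n : ℝ)) * r) atTop (𝓝 (c ^ (0 : ℝ) * r)) :=
    (((Real.continuous_const_rpow hc.ne').tendsto 0).comp tendsto_one_div_atTop_nhds_zero_nat
      ).mul_const r
  rw [Real.rpow_zero, one_mul] at h1
  refine h1.congr' ?_
  filter_upwards [eventually_ge_atTop 1] with n hn
  rw [Real.mul_rpow hc.le (by positivity), one_div, Real.pow_rpow_inv_natCast hr (by omega)]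

/-- The heights lie between `c * δ ^ n` and `A * r ^ n` for each `r > δ`, and constants disappear
under `n`-th roots. -/
theorem hasArithmeticDegree_of_le_height (f : AffineMorphism k) (hδ : 1 < f.dynamicalDegree)
    (P : Fin 2 → L) {c : ℝ} (hc : 0 < c)
    (h : ∀ n, c * f.dynamicalDegree ^ n ≤ height (f.onPoints^[n] P)) :
    f.HasArithmeticDegree P f.dynamicalDegree := by
  refine tendsto_order.mpr ⟨fun a ha => ?_, fun b hb => ?_⟩
  · filter_upwards [(tendsto_const_mul_pow_root hc (by linarith)).eventually_const_lt ha] with n hn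
    refine hn.trans_le (Real.rpow_le_rpow (by positivity) ?_ (by positivity))
    exact (h n).trans (le_max_right _ _)
  · obtain ⟨r, hr, hrb⟩ := exists_between hb
    obtain ⟨A, hA, hle⟩ := height_iterate_le f (hδ.trans hr) hr P
    filter_upwards [(tendsto_const_mul_pow_root hA (by linarith)).eventually_lt_const hrb] with n hn
    exact (Real.rpow_le_rpow (by positivity) (hle n) (by positivity)).trans_lt hn

theorem weakLowerCanonicalHeight_pos_of_le_height (f : AffineMorphism k)
    (hδ : 1 < f.dynamicalDegree) (P : Fin 2 → L) {c : ℝ} (hc : 0 < c)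
    (h : ∀ n, c * f.dynamicalDegree ^ n ≤ height (f.onPoints^[n] P)) :
    0 < f.weakLowerCanonicalHeight P := by
  refine lt_of_lt_of_le (EReal.coe_pos.mpr hc) (le_liminf_of_le (by isBoundedDefault) ?_)
  filter_upwards with n
  have : 0 < f.dynamicalDegree ^ n := by positivity
  exact EReal.coe_le_coe_iff.mpr ((le_div_iff₀ this).mpr (h n))

end ArithmeticDegree

end AffineMorphism

open NumberField.HeightOneSpectrum in
theorem adicAbv_eq_zpow {L : Type*} [Field L] [NumberField L]
    (p : IsDedekindDomain.HeightOneSpectrum (𝓞 L)) {x : L} (hx : x ≠ 0) :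
    adicAbv L p x = (Ideal.absNorm p.asIdeal : ℝ) ^ (p.valuation L x).log := by
  have h : p.valuation L x ≠ 0 := (Valuation.ne_zero_iff _).mpr hx
  rw [adicAbv_def]
  nth_rewrite 1 [← WithZero.exp_log h]
  rw [WithZeroMulInt.toNNReal_neg_apply _ WithZero.exp_ne_zero]
  rfl

/-! ### Open sets of the projective plane, disjoint orbits and density -/

section ProjectiveOpen

variable {E : Type*} [NormedField E]

/-- The points of the projective plane where the form `a` is smaller than the form `b`. -/
def projLTSet (a b : (Fin 3 → E) → E) : Set (ℙ E (Fin 3 → E)) :=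
  {q | ‖a q.rep‖ < ‖b q.rep‖}

/-- Both sides scale by the same power `c ^ k`, so the comparison does not depend on the
representative. -/
theorem mk_mem_projLTSet {a b : (Fin 3 → E) → E} {k : ℕ}
    (ha : ∀ (c : E) v, a (c • v) = c ^ k * a v) (hb : ∀ (c : E) v, b (c • v) = c ^ k * b v)
    {v : Fin 3 → E} (hv : v ≠ 0) :
    Projectivization.mk E v hv ∈ projLTSet a b ↔ ‖a v‖ < ‖b v‖ := by
  obtain ⟨u, hu⟩ := Projectivization.exists_smul_eq_mk_rep E v hv
  rw [projLTSet, Set.mem_ofPred_eq, ← hu, Units.smul_def, ha, hb, norm_mul, norm_mul]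
  exact mul_lt_mul_iff_right₀ (norm_pos_iff.mpr (pow_ne_zero _ u.ne_zero))

theorem isOpen_projLTSet {a b : (Fin 3 → E) → E} {k : ℕ}
    (ha : ∀ (c : E) v, a (c • v) = c ^ k * a v) (hb : ∀ (c : E) v, b (c • v) = c ^ k * b v)
    (hac : Continuous a) (hbc : Continuous b) : IsOpen (projLTSet a b) := by
  refine isOpen_coinduced.mpr ?_
  have h : Projectivization.mk' E ⁻¹' projLTSet a b =
      {v : {v : Fin 3 → E // v ≠ 0} | ‖a v‖ < ‖b v‖} := by
    ext ⟨v, hv⟩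
    exact mk_mem_projLTSet ha hb hv
  rw [h]
  exact isOpen_lt (hac.comp continuous_subtype_val).norm (hbc.comp continuous_subtype_val).norm

end ProjectiveOpen

theorem norm_algebraMap_adicCompletion {L : Type*} [Field L] [NumberField L]
    (p : IsDedekindDomain.HeightOneSpectrum (𝓞 L)) (x : L) :
    ‖algebraMap L (p.adicCompletion L) x‖ = NumberField.HeightOneSpectrum.adicAbv L p x :=
  FinitePlace.norm_embedding p x

/-- If a semiconjugacy `T` to an injective map `M` separates the points `s a` and takes them to
values that `M` does not take, then the orbits of these points are pairwise disjoint. -/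
theorem pairwiseDisjoint_range_iterate {α ι κ : Type*} {F : α → α} {R : Set α}
    (hR : ∀ x ∈ R, F x ∈ R) {T : α → ι} {M : ι → ι} (hM : M.Injective)
    (hT : ∀ x ∈ R, T (F x) = M (T x)) {s : κ → α} (hs : ∀ a, s a ∈ R)
    (hTs : Function.Injective fun a => T (s a)) (hTM : ∀ a, ∀ x ∈ R, T (s a) ≠ M (T x)) :
    (Set.range s).PairwiseDisjoint fun x => Set.range fun n : ℕ => F^[n] x := by
  have hRn : ∀ n : ℕ, ∀ x ∈ R, F^[n] x ∈ R := by
    intro n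
    induction n with
    | zero => exact fun x hx => hx
    | succ n ih => exact fun x hx => by rw [Function.iterate_succ_apply']; exact hR _ (ih x hx)
  have hTn : ∀ n : ℕ, ∀ x ∈ R, T (F^[n] x) = M^[n] (T x) := by
    intro n
    induction n with
    | zero => exact fun x hx => rfl
    | succ n ih =>
      intro x hx
      rw [Function.iterate_succ_apply', Function.iterate_succ_apply', hT _ (hRn n x hx), ih x hx]
  have key : ∀ a b (m n : ℕ), m ≤ n → F^[m] (s a) = F^[n] (s b) → a = b := by
    intro a b m n hmn h
    obtain ⟨j, rfl⟩ := Nat.exists_eq_add_of_le hmn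
    have h1 := congrArg T h
    rw [Function.iterate_add_apply, hTn _ _ (hs a), hTn _ _ (hRn j _ (hs b))] at h1
    -- Cancelling `M^[m]` leaves `T (s a) = M^[j] (T (s b))`: for `j = 0` the values of `T` separate
    -- the points, for `j > 0` the left side would be a value of `M`.
    have h2 := hM.iterate m h1
    cases j with
    | zero => exact hTs h2
    | succ j =>
      rw [Function.iterate_succ_apply', hT _ (hRn j _ (hs b))] at h2
      exact absurd h2 (hTM a _ (hRn j _ (hs b)))
  rintro _ ⟨a, rfl⟩ _ ⟨b, rfl⟩ hab
  refine Set.disjoint_left.mpr ?_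
  rintro _ ⟨m, rfl⟩ ⟨n, hn⟩
  refine hab ?_
  rcases le_total m n with h | h
  · rw [key a b m n h hn.symm]
  · rw [key b a n m h hn]

theorem eval_aeval_polynomial {L σ : Type*} [CommRing L] (g : MvPolynomial σ L)
    (q : σ → Polynomial L) (z : L) :
    (aeval q g).eval z = eval (fun i => (q i).eval z) g := by
  induction g using MvPolynomial.induction_on with
  | C a => simp
  | add a b ha hb => simp [ha, hb]
  | mul_X a i ha => simp [ha]

namespace AffineMorphism

/-- Infinitely many points on each curve of a sequence of parallel translates are dense. -/
theorem zariskiDense_range_translates {L : Type*} [Field L] [CharZero L]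
    (A : Fin 2 → Polynomial L) (B : Fin 2 → L)
    (hAB : ∀ Q : Fin 2 → L, ∃ t c, ∀ i, Q i = (A i).eval t + c * B i)
    (t : ℕ → ℕ → L) (ht : ∀ c, (t c).Injective) :
    ZariskiDense (Set.range fun a : ℕ × ℕ => fun i => (A i).eval (t a.1 a.2) + a.1 * B i) := by
  intro g hg
  have hG := eval_aeval_polynomial g
  have h1 : ∀ (c : ℕ) (z : L), eval (fun i => (A i).eval z + c * B i) g = 0 := by
    intro c z
    -- On a fixed translate `g` is a one-variable polynomial in the parameter, with infinitely many
    -- roots.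
    have h0 : aeval (fun i => A i + Polynomial.C ((c : L) * B i)) g = 0 := by
      refine Polynomial.eq_zero_of_infinite_isRoot _
        ((Set.infinite_range_of_injective (ht c)).mono ?_)
      rintro _ ⟨j, rfl⟩
      have := hg _ ⟨(c, j), rfl⟩
      simp only [Set.mem_ofPred_eq, Polynomial.IsRoot.def, hG, Polynomial.eval_add,
        Polynomial.eval_C]
      exact this
    have := hG (fun i => A i + Polynomial.C ((c : L) * B i)) z
    rw [h0, Polynomial.eval_zero] at this
    simpa using this.symm
  have h2 : ∀ (z c : L), eval (fun i => (A i).eval z + c * B i) g = 0 := by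
    intro z c
    -- Now the parameter is fixed and the translation varies; the natural numbers give infinitely
    -- many roots in characteristic zero.
    have h0 : aeval (fun i => Polynomial.C ((A i).eval z) +
        (Polynomial.X * Polynomial.C (B i) : Polynomial L)) g
        = 0 := by
      refine Polynomial.eq_zero_of_infinite_isRoot _
        ((Set.infinite_range_of_injective (Nat.cast_injective (R := L))).mono ?_)
      rintro _ ⟨j, rfl⟩
      simp only [Set.mem_ofPred_eq, Polynomial.IsRoot.def, hG, Polynomial.eval_add,
        Polynomial.eval_C, Polynomial.eval_mul, Polynomial.eval_X]
      exact h1 j z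
    have := hG (fun i => Polynomial.C ((A i).eval z) +
      (Polynomial.X * Polynomial.C (B i) : Polynomial L)) c
    rw [h0, Polynomial.eval_zero] at this
    simpa only [Polynomial.eval_add, Polynomial.eval_C, Polynomial.eval_mul, Polynomial.eval_X]
      using this.symm
  refine MvPolynomial.funext fun Q => ?_
  obtain ⟨z, c, hQ⟩ := hAB Q
  rw [_root_.funext hQ, h2, map_zero]

/-! ### The criterion: an invariant region with fast growth -/

section Conclusion

variable {K : Type*} [Field K]

/-- The weak lower canonical height of `f` is positive at the `L`-points of a nonempty `p`-adically
open set, and a Zariski dense set of `L`-points with disjoint orbits has arithmetic degree equal to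
the dynamical degree. -/
def HasLargeOrbitsOver (f : AffineMorphism K) (L : Type*) [Field L] [NumberField L]
    [Algebra K L] : Prop :=
  (∃ (p : IsDedekindDomain.HeightOneSpectrum (𝓞 L))
      (U : Set (ℙ (p.adicCompletion L) (Fin 3 → p.adicCompletion L))),
      IsOpen U ∧ U.Nonempty ∧
      ∀ P : Fin 2 → L, toProj (fun i => algebraMap L (p.adicCompletion L) (P i)) ∈ U →
          0 < f.weakLowerCanonicalHeight P) ∧
    ∃ S : Set (Fin 2 → L), ZariskiDense S ∧ S.PairwiseDisjoint (fun P => f.orbit P) ∧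
      ∀ P ∈ S, f.HasArithmeticDegree P f.dynamicalDegree

variable {L : Type*} [Field L] [NumberField L] [Algebra K L]

open NumberField.HeightOneSpectrum in
theorem exists_le_height_of_exists_le_log (f : AffineMorphism K)
    (p : IsDedekindDomain.HeightOneSpectrum (𝓞 L)) (P : Fin 2 → L) {r : ℝ}
    (h : ∃ c, 0 < c ∧ ∀ n, ∃ i, c * r ^ n ≤ Real.log (adicAbv L p (f.onPoints^[n] P i))) :
    ∃ c, 0 < c ∧ ∀ n, c * r ^ n ≤ height (f.onPoints^[n] P) := by
  obtain ⟨c, hc, h⟩ := h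
  refine ⟨c / Module.finrank ℚ L, div_pos hc finrank_pos_real, fun n => ?_⟩
  obtain ⟨i, hi⟩ := h n
  refine le_trans ?_ (log_adicAbv_le_height p _ i)
  rw [div_mul_eq_mul_div]
  exact div_le_div_of_nonneg_right hi (Nat.cast_nonneg _)

open NumberField.HeightOneSpectrum in
/-- An invariant set `R` of `L`-points on which the `p`-adic size grows at the rate of the
dynamical degree, and which contains the `L`-points of a `p`-adically open set `U`, gives points
with positive weak lower canonical height and a dense set of points with arithmetic degree equal
to the dynamical degree. -/
theorem exists_of_invariant_region (f : AffineMorphism K) (hδ : 1 < f.dynamicalDegree)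
    (p : IsDedekindDomain.HeightOneSpectrum (𝓞 L)) (R : Set (Fin 2 → L))
    (hR : ∀ P ∈ R, f.onPoints P ∈ R)
    (hgrow : ∀ P ∈ R, ∃ c, 0 < c ∧ ∀ n, ∃ i,
      c * f.dynamicalDegree ^ n ≤ Real.log (adicAbv L p (f.onPoints^[n] P i)))
    (U : Set (ℙ (p.adicCompletion L) (Fin 3 → p.adicCompletion L))) (hU : IsOpen U)
    (hUR : ∀ P : Fin 2 → L, toProj (fun i => algebraMap L (p.adicCompletion L) (P i)) ∈ U → P ∈ R)
    {ι : Type*} (T : (Fin 2 → L) → ι) (M : ι → ι) (hM : M.Injective)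
    (hT : ∀ P ∈ R, T (f.onPoints P) = M (T P))
    (A : Fin 2 → Polynomial L) (B : Fin 2 → L)
    (hAB : ∀ Q : Fin 2 → L, ∃ t c, ∀ i, Q i = (A i).eval t + c * B i)
    (t : ℕ → ℕ → L) (ht : ∀ c, (t c).Injective)
    (hSU : ∀ a : ℕ × ℕ, toProj (fun i => algebraMap L (p.adicCompletion L)
      ((A i).eval (t a.1 a.2) + a.1 * B i)) ∈ U)
    (hTS : Function.Injective fun a : ℕ × ℕ => T fun i => (A i).eval (t a.1 a.2) + a.1 * B i)
    (hTM : ∀ a : ℕ × ℕ, ∀ P ∈ R, T (fun i => (A i).eval (t a.1 a.2) + a.1 * B i) ≠ M (T P)) :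
    f.HasLargeOrbitsOver L := by
  refine ⟨⟨p, U, hU, ⟨_, hSU (0, 0)⟩, fun P hP => ?_⟩, _,
    zariskiDense_range_translates A B hAB t ht,
    pairwiseDisjoint_range_iterate hR hM hT (fun a => hUR _ (hSU a)) hTS hTM, ?_⟩
  · obtain ⟨c, hc, h⟩ := exists_le_height_of_exists_le_log f p P (hgrow P (hUR P hP))
    exact weakLowerCanonicalHeight_pos_of_le_height f hδ P hc h
  · rintro _ ⟨a, rfl⟩
    obtain ⟨c, hc, h⟩ := exists_le_height_of_exists_le_log f p _ (hgrow _ (hUR _ (hSU a)))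
    exact hasArithmeticDegree_of_le_height f hδ _ hc h

end Conclusion

end AffineMorphism

/-! ### Nonarchimedean estimates -/

section Nonarchimedean

variable {L : Type*} [Field L] {w : AbsoluteValue L ℝ}

theorem IsNonarchimedean.apply_sum_lt_of_forall {ι : Type*} (hw : IsNonarchimedean w)
    (s : Finset ι) (a : ι → L) {B : ℝ} (hB : 0 < B) (h : ∀ i ∈ s, w (a i) < B) :
    w (∑ i ∈ s, a i) < B := by
  classical
  induction s using Finset.induction_on with
  | empty => simpa using hB
  | insert i s hi ih =>
    rw [Finset.sum_insert hi]
    exact (hw _ _).trans_lt (max_lt (h i (Finset.mem_insert_self i s))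
      (ih fun j hj => h j (Finset.mem_insert_of_mem hj)))

theorem IsNonarchimedean.apply_add_lt (hw : IsNonarchimedean w) {a b : L} {B : ℝ}
    (ha : w a < B) (hb : w b < B) : w (a + b) < B :=
  (hw a b).trans_lt (max_lt ha hb)

theorem IsNonarchimedean.apply_sub_lt (hw : IsNonarchimedean w) {a b : L} {B : ℝ}
    (ha : w a < B) (hb : w b < B) : w (a - b) < B := by
  rw [sub_eq_add_neg]
  exact hw.apply_add_lt ha (by rwa [w.map_neg])

/-- The isosceles triangle principle; it identifies the absolute value of a sum with that of its
dominant term. -/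
theorem IsNonarchimedean.apply_eq_of_sub_lt (hw : IsNonarchimedean w) {a b : L}
    (h : w (a - b) < w b) : w a = w b := by
  refine le_antisymm ?_ (le_of_not_gt fun hlt => ?_)
  · calc w a = w ((a - b) + b) := by rw [sub_add_cancel]
      _ ≤ max (w (a - b)) (w b) := hw _ _
      _ = w b := max_eq_right h.le
  · have := hw.apply_sub_lt hlt h
    rw [sub_sub_cancel] at this
    exact lt_irrefl _ this

theorem IsNonarchimedean.apply_le_of_sub_lt (hw : IsNonarchimedean w) {a b : L} {B : ℝ}
    (h : w (a - b) < B) (hb : w b ≤ B) : w a ≤ B :=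
  calc w a = w ((a - b) + b) := by rw [sub_add_cancel]
    _ ≤ max (w (a - b)) (w b) := hw _ _
    _ ≤ B := max_le h.le hb

theorem IsNonarchimedean.apply_mul_sub_mul_lt (hw : IsNonarchimedean w) {a b a' b' : L} {A B : ℝ}
    (hA : 0 < A) (hB : 0 < B) (ha : w a ≤ A) (hb' : w b' ≤ B) (haa : w (a - a') < A)
    (hbb : w (b - b') < B) : w (a * b - a' * b') < A * B := by
  have e : a * b - a' * b' = a * (b - b') + (a - a') * b' := by ring
  rw [e]
  refine hw.apply_add_lt ?_ ?_
  · rw [map_mul]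
    exact mul_lt_mul_of_le_of_lt_of_nonneg_of_pos ha hbb (w.nonneg _) hA
  · rw [map_mul]
    exact mul_lt_mul_of_lt_of_le_of_nonneg_of_pos haa hb' (w.nonneg _) hB

theorem IsNonarchimedean.apply_pow_sub_pow_lt (hw : IsNonarchimedean w) {a a' : L} {A : ℝ}
    (hA : 0 < A) (ha : w a ≤ A) (ha' : w a' ≤ A) (haa : w (a - a') < A) (n : ℕ) :
    w (a ^ n - a' ^ n) < A ^ n := by
  induction n with
  | zero => simp
  | succ n ih =>
    rw [pow_succ, pow_succ, pow_succ]
    refine hw.apply_mul_sub_mul_lt (by positivity) hA ?_ ha' ih haa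
    rw [map_pow]
    exact pow_le_pow_left₀ (w.nonneg _) ha n

end Nonarchimedean

namespace AffineMorphism

/-! ### Residue classes at infinity -/

section ResidueClass

variable {K : Type*} [Field K] {L : Type*} [Field L] [Algebra K L] {w : AbsoluteValue L ℝ}

/-- Far away from the origin, a polynomial is approximated by its leading form. -/
theorem abv_aeval_sub_lt (hw : IsNonarchimedean w) {g : MvPolynomial (Fin 2) K} {d : ℕ}
    (hd : g.totalDegree ≤ d) (hg : ∀ s, w (algebraMap K L (g.coeff s)) ≤ 1)
    {P v : Fin 2 → L} {y : L} (hy : 1 < w y) (hv : ∀ l, w (v l) ≤ 1)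
    (hP : ∀ l, w (P l - v l * y) < w y) :
    w (aeval P g - y ^ d * aeval v (homogeneousComponent d g)) < w y ^ d := by
  have hy0 : 0 < w y := by linarith
  have hvy : ∀ l, w (v l * y) ≤ w y := fun l => by
    rw [map_mul]; exact mul_le_of_le_one_left hy0.le (hv l)
  have hPy : ∀ l, w (P l) ≤ w y := fun l => hw.apply_le_of_sub_lt (hP l) (hvy l)
  have e1 : aeval P g = ∑ s ∈ g.support,
      algebraMap K L (g.coeff s) * (P 0 ^ s 0 * P 1 ^ s 1) := by
    rw [aeval_def, eval₂_eq']
    simp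
  have e2 : y ^ d * aeval v (homogeneousComponent d g) = ∑ s ∈ g.support,
      if s 0 + s 1 = d then algebraMap K L (g.coeff s) * ((v 0 * y) ^ s 0 * (v 1 * y) ^ s 1)
      else 0 := by
    rw [homogeneousComponent_apply, map_sum, Finset.sum_filter, Finset.mul_sum]
    refine Finset.sum_congr rfl fun s _ => ?_
    have hs : Finsupp.degree s = s 0 + s 1 := by
      rw [Finsupp.degree_eq_sum, Fin.sum_univ_two]
    rw [hs]
    split_ifs with h
    · rw [aeval_monomial, Finsupp.prod_fintype _ _ (by simp), Fin.prod_univ_two, ← h]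
      ring
    · simp
  rw [e1, e2, ← Finset.sum_sub_distrib]
  refine hw.apply_sum_lt_of_forall _ _ (by positivity) fun s hs => ?_
  have hsd := le_of_mem_support hd hs
  have hwP : ∀ l n, w (P l ^ n) ≤ w y ^ n := fun l n => by
    rw [map_pow]; exact pow_le_pow_left₀ (w.nonneg _) (hPy l) n
  -- A monomial of degree `d` changes by less than `w y ^ d` when `P` is replaced by `v * y`; a
  -- monomial of lower degree is itself smaller than that, because `1 < w y`.
  split_ifs with h
  · rw [← mul_sub, map_mul]
    refine (mul_le_of_le_one_left (w.nonneg _) (hg s)).trans_lt ?_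
    rw [← h, pow_add]
    refine hw.apply_mul_sub_mul_lt (by positivity) (by positivity) (hwP 0 _) ?_
      (hw.apply_pow_sub_pow_lt hy0 (hPy 0) (hvy 0) (hP 0) _)
      (hw.apply_pow_sub_pow_lt hy0 (hPy 1) (hvy 1) (hP 1) _)
    rw [map_pow]
    exact pow_le_pow_left₀ (w.nonneg _) (hvy 1) _
  · rw [sub_zero, map_mul]
    refine (mul_le_of_le_one_left (w.nonneg _) (hg s)).trans_lt ?_
    calc w (P 0 ^ s 0 * P 1 ^ s 1) ≤ w y ^ s 0 * w y ^ s 1 := by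
          rw [map_mul]
          exact mul_le_mul (hwP 0 _) (hwP 1 _) (w.nonneg _) (by positivity)
      _ = w y ^ (s 0 + s 1) := (pow_add _ _ _).symm
      _ < w y ^ d := pow_lt_pow_right₀ hy (by omega)

/-- The leading forms of the components of `f`, of degree `deg f`. -/
def leadingForm (f : AffineMorphism K) (l : Fin 2) : MvPolynomial (Fin 2) K :=
  homogeneousComponent f.degree (f l)

/-- The vector with `i`-th coordinate `1` and other coordinate `ξ`. -/
def slopeVec (i : Fin 2) (ξ : L) : Fin 2 → L := fun l => if l = i then 1 else ξ

theorem slopeVec_self (i : Fin 2) (ξ : L) : slopeVec i ξ i = 1 := if_pos rfl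

theorem slopeVec_of_ne {i j : Fin 2} (h : j ≠ i) (ξ : L) : slopeVec i ξ j = ξ := if_neg h

theorem forall_fin_two_of_ne {i j : Fin 2} (h : j ≠ i) {p : Fin 2 → Prop} :
    (∀ l, p l) ↔ p i ∧ p j :=
  ⟨fun H => ⟨H i, H j⟩, fun ⟨hi, hj⟩ l => by
    rcases (by omega : l = i ∨ l = j) with rfl | rfl <;> assumption⟩

/-- The points whose reduction lies at infinity, with slope in `Ξ`. -/
def residueRegion (w : AbsoluteValue L ℝ) (i j : Fin 2) (Ξ : Set L) : Set (Fin 2 → L) :=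
  {P | 1 < w (P i) ∧ ∃ ξ ∈ Ξ, w (P j - ξ * P i) < w (P i)}

/-- Up to smaller terms `P` is `P i` times the slope vector of `ξ`, so `f P` is `P i ^ d` times the
leading forms there. The `i`-th form is a unit at that vector, which gives the size, and the ratio
of the forms reduces to `η`, which gives the new slope. -/
theorem onPoints_mem_residueRegion (hw : IsNonarchimedean w) (f : AffineMorphism K)
    (hd : f.degree ≠ 0) (hf : ∀ l s, w (algebraMap K L ((f l).coeff s)) ≤ 1)
    {i j : Fin 2} (hij : j ≠ i) {Ξ : Set L}
    (hΞ : ∀ ξ ∈ Ξ, w ξ ≤ 1 ∧ w (aeval (slopeVec i ξ) (f.leadingForm i)) = 1 ∧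
      ∃ η ∈ Ξ, w (aeval (slopeVec i ξ) (f.leadingForm j) -
        η * aeval (slopeVec i ξ) (f.leadingForm i)) < 1)
    {P : Fin 2 → L} (hP : P ∈ residueRegion w i j Ξ) :
    f.onPoints P ∈ residueRegion w i j Ξ ∧ w (f.onPoints P i) = w (P i) ^ f.degree := by
  obtain ⟨hy, ξ, hξ, hPξ⟩ := hP
  obtain ⟨hξ1, hα, η, hη, hβ⟩ := hΞ ξ hξ
  have hv : ∀ l, w (slopeVec i ξ l) ≤ 1 := by
    rw [forall_fin_two_of_ne hij, slopeVec_self, slopeVec_of_ne hij, map_one]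
    exact ⟨le_rfl, hξ1⟩
  have hPv : ∀ l, w (P l - slopeVec i ξ l * P i) < w (P i) := by
    rw [forall_fin_two_of_ne hij, slopeVec_self, slopeVec_of_ne hij, one_mul, sub_self, map_zero]
    exact ⟨by linarith, hPξ⟩
  have hY : 0 < w (P i) ^ f.degree := by positivity
  have ha := fun l => abv_aeval_sub_lt hw (totalDegree_le_degree f l) (hf l) hy hv hPv
  have hi := ha i
  have hj := ha j
  have hE : w (f.onPoints P i) = w (P i) ^ f.degree := by
    have h1 : w (P i ^ f.degree * aeval (slopeVec i ξ) (f.leadingForm i)) = w (P i) ^ f.degree := by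
      rw [map_mul, map_pow, hα, mul_one]
    rw [← h1]
    exact hw.apply_eq_of_sub_lt (by rw [h1]; exact hi)
  refine ⟨⟨?_, η, hη, ?_⟩, hE⟩
  · rw [hE]; exact one_lt_pow₀ hy hd
  · rw [hE]
    have e : f.onPoints P j - η * f.onPoints P i =
        (f.onPoints P j - P i ^ f.degree * aeval (slopeVec i ξ) (f.leadingForm j)) +
        (P i ^ f.degree * (aeval (slopeVec i ξ) (f.leadingForm j) -
          η * aeval (slopeVec i ξ) (f.leadingForm i)) -
        η * (f.onPoints P i - P i ^ f.degree * aeval (slopeVec i ξ) (f.leadingForm i))) := by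
      ring
    rw [e]
    refine hw.apply_add_lt hj (hw.apply_sub_lt ?_ ?_)
    · rw [map_mul, map_pow]
      exact mul_lt_of_lt_one_right hY hβ
    · rw [map_mul]
      exact (mul_le_of_le_one_left (w.nonneg _) (hΞ η hη).1).trans_lt hi

end ResidueClass

end AffineMorphism

/-! ### Pole orders at a prime -/

section Order

variable {L : Type*} [Field L] [NumberField L] (p : IsDedekindDomain.HeightOneSpectrum (𝓞 L))

/-- The exponent of `p` in the denominator of `x`. -/
def poleOrder (x : L) : ℤ := (p.valuation L x).log

variable {p}

theorem poleOrder_mul {x y : L} (hx : x ≠ 0) (hy : y ≠ 0) :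
    poleOrder p (x * y) = poleOrder p x + poleOrder p y := by
  rw [poleOrder, map_mul, WithZero.log_mul ((Valuation.ne_zero_iff _).mpr hx)
    ((Valuation.ne_zero_iff _).mpr hy)]
  rfl

theorem poleOrder_pow (x : L) (n : ℕ) : poleOrder p (x ^ n) = n * poleOrder p x := by
  rw [poleOrder, map_pow, WithZero.log_pow, nsmul_eq_mul]
  rfl

theorem one_lt_absNorm_real : (1 : ℝ) < Ideal.absNorm p.asIdeal := by
  exact_mod_cast NumberField.HeightOneSpectrum.one_lt_absNorm p

open NumberField.HeightOneSpectrum in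
theorem poleOrder_congr {x y : L} (hx : x ≠ 0) (hy : y ≠ 0)
    (h : adicAbv L p x = adicAbv L p y) : poleOrder p x = poleOrder p y := by
  rw [adicAbv_eq_zpow p hx, adicAbv_eq_zpow p hy] at h
  exact zpow_right_injective₀ (by linarith [one_lt_absNorm_real (p := p)])
    one_lt_absNorm_real.ne' h

variable (p)

open NumberField.HeightOneSpectrum in
theorem exists_poleOrder_eq_one :
    ∃ x : L, x ≠ 0 ∧ poleOrder p x = 1 ∧ 1 < adicAbv L p x := by
  obtain ⟨x, hx⟩ := p.valuation_exists_uniformizer L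
  have hx0 : x ≠ 0 := by
    rintro rfl
    rw [map_zero] at hx
    exact WithZero.exp_ne_zero hx.symm
  have h1 : poleOrder p x⁻¹ = 1 := by
    rw [poleOrder, map_inv₀, WithZero.log_inv, hx, WithZero.log_exp, neg_neg]
  refine ⟨x⁻¹, inv_ne_zero hx0, h1, ?_⟩
  have := adicAbv_eq_zpow p (inv_ne_zero hx0)
  rw [poleOrder] at h1
  rw [this, h1, zpow_one]
  exact one_lt_absNorm_real

end Order

namespace AffineMorphism

section ResidueClass

variable {K : Type*} [Field K] {L : Type*} [Field L] [NumberField L] [Algebra K L]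

theorem affine_coord {E : Type*} [One E] (P : Fin 2 → E) (i : Fin 2) :
    (![P 0, P 1, 1] : Fin 3 → E) i.castSucc = P i := by
  fin_cases i <;> rfl

theorem eventually_iterate_eq_pow {α : Type*} {F : α → α} {R : Set α} {φ : α → ℝ} {d : ℕ}
    (hR : ∀ x ∈ R, F x ∈ R ∧ φ (F x) = φ x ^ d) {x : α} (hx : x ∈ R) (n : ℕ) :
    F^[n] x ∈ R ∧ φ (F^[n] x) = φ x ^ d ^ n := by
  induction n with
  | zero => simpa using hx
  | succ n ih =>
    rw [Function.iterate_succ_apply', (hR _ ih.1).2, ih.2, ← pow_mul, ← pow_succ]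
    exact ⟨(hR _ ih.1).1, rfl⟩

open NumberField.HeightOneSpectrum in
-- In this region `f` multiplies the pole order of the `i`-th coordinate by `d`. Hence points with
-- pole order congruent to `1` modulo `d ≥ 2` are not images of points of the region, and different
-- pole orders of this kind give disjoint orbits.
theorem hasLargeOrbitsOver_of_residueRegion (f : AffineMorphism K) (hδ : 1 < f.dynamicalDegree)
    (p : IsDedekindDomain.HeightOneSpectrum (𝓞 L)) (hd : 2 ≤ f.degree)
    (hf : ∀ l s, adicAbv L p (algebraMap K L ((f l).coeff s)) ≤ 1)
    {i j : Fin 2} (hij : j ≠ i) {Ξ : Set L}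
    (hΞ : ∀ ξ ∈ Ξ, adicAbv L p ξ ≤ 1 ∧
      adicAbv L p (aeval (slopeVec i ξ) (f.leadingForm i)) = 1 ∧
      ∃ η ∈ Ξ, adicAbv L p (aeval (slopeVec i ξ) (f.leadingForm j) -
        η * aeval (slopeVec i ξ) (f.leadingForm i)) < 1)
    (hne : Ξ.Nonempty) : f.HasLargeOrbitsOver L := by
  obtain ⟨ξ, hξ⟩ := hne
  have hw := isNonarchimedean_adicAbv L p
  obtain ⟨ϖ, hϖ0, hϖ1, hϖ⟩ := exists_poleOrder_eq_one (L := L) p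
  set R := residueRegion (adicAbv L p) i j Ξ with hRdef
  have hstep : ∀ P ∈ R, f.onPoints P ∈ R ∧
      adicAbv L p (f.onPoints P i) = adicAbv L p (P i) ^ f.degree := fun P hP =>
    onPoints_mem_residueRegion hw f (by omega) hf hij hΞ hP
  have hR0 : ∀ P ∈ R, P i ≠ 0 := fun P hP h0 => by
    have := hP.1
    rw [h0, map_zero] at this
    linarith
  let E := p.adicCompletion L
  let ξE : E := algebraMap L E ξ
  let a₁ : (Fin 3 → E) → E := fun v => v j.castSucc - ξE * v i.castSucc
  let a₂ : (Fin 3 → E) → E := fun v => v 2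
  let b : (Fin 3 → E) → E := fun v => v i.castSucc
  have ha₁ : ∀ (c : E) v, a₁ (c • v) = c ^ 1 * a₁ v := fun c v => by
    simp only [a₁, Pi.smul_apply, smul_eq_mul]; ring
  have ha₂ : ∀ (c : E) v, a₂ (c • v) = c ^ 1 * a₂ v := fun c v => by
    simp only [a₂, Pi.smul_apply, smul_eq_mul]; ring
  have hb : ∀ (c : E) v, b (c • v) = c ^ 1 * b v := fun c v => by
    simp only [b, Pi.smul_apply, smul_eq_mul]; ring
  have hU : ∀ P : Fin 2 → L, toProj (fun l => algebraMap L E (P l)) ∈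
      projLTSet a₁ b ∩ projLTSet a₂ b ↔
      adicAbv L p (P j - ξ * P i) < adicAbv L p (P i) ∧ 1 < adicAbv L p (P i) := by
    intro P
    rw [Set.mem_inter_iff, toProj, mk_mem_projLTSet ha₁ hb, mk_mem_projLTSet ha₂ hb]
    simp only [a₁, a₂, b, affine_coord (fun l => algebraMap L E (P l)), ξE, ← map_mul, ← map_sub,
      E, norm_algebraMap_adicCompletion]
    simp
  -- `Nat.pair` makes the exponents distinct for all pairs `(c, n)`, and the `+ 1` keeps them away
  -- from the multiples of the degree.
  let t : ℕ → ℕ → L := fun c n => ϖ ^ (f.degree * Nat.pair c n + 1)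
  have htw : ∀ c n, 1 < adicAbv L p (t c n) := fun c n => by
    simp only [t, map_pow]
    exact one_lt_pow₀ hϖ (by omega)
  have htT : ∀ c n, poleOrder p (t c n) = f.degree * Nat.pair c n + 1 := fun c n => by
    simp only [t]
    rw [poleOrder_pow, hϖ1]
    push_cast
    ring
  -- The curves are the lines of slope `ξ`, translated in the `j`-th direction; a translation by a
  -- natural number is `p`-integral and does not leave the residue class.
  let A : Fin 2 → Polynomial L := fun l => if l = i then Polynomial.X
    else Polynomial.C ξ * Polynomial.X
  let B : Fin 2 → L := fun l => if l = i then 0 else 1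
  have hAi : ∀ z c, (A i).eval z + c * B i = z := fun z c => by simp [A, B]
  have hAj : ∀ z c, (A j).eval z + c * B j = ξ * z + c := fun z c => by simp [A, B, hij]
  have hd0 : (f.degree : ℤ) ≠ 0 := by omega
  refine exists_of_invariant_region f hδ p R (fun P hP => (hstep P hP).1) ?_
    (projLTSet a₁ b ∩ projLTSet a₂ b) ?_ ?_ (fun P => poleOrder p (P i))
    (fun n => f.degree * n) (mul_right_injective₀ hd0) ?_ A B ?_ t ?_ ?_ ?_ ?_
  · intro P hP
    have h1 := hP.1
    refine ⟨Real.log (adicAbv L p (P i)), Real.log_pos h1, fun n => ⟨i, ?_⟩⟩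
    have h2 := (eventually_iterate_eq_pow (φ := fun P => adicAbv L p (P i)) hstep hP n).2
    rw [h2, Real.log_pow, mul_comm]
    refine mul_le_mul_of_nonneg_right ?_ (Real.log_pos h1).le
    push_cast
    exact pow_le_pow_left₀ (by linarith) (dynamicalDegree_le_degree f (by omega)) n
  · exact (isOpen_projLTSet ha₁ hb (by fun_prop) (by fun_prop)).inter
      (isOpen_projLTSet ha₂ hb (by fun_prop) (by fun_prop))
  · intro P hP
    have := (hU P).mp hP
    exact ⟨this.2, ξ, hξ, this.1⟩
  · intro P hP
    have h := hstep P hP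
    rw [← map_pow] at h
    rw [poleOrder_congr (hR0 _ h.1) (pow_ne_zero _ (hR0 P hP)) h.2, poleOrder_pow]
  · intro Q
    refine ⟨Q i, Q j - ξ * Q i, ?_⟩
    rw [forall_fin_two_of_ne hij, hAi, hAj]
    exact ⟨rfl, by ring⟩
  · intro c m n h
    have h1 := congrArg (poleOrder p) h
    rw [htT, htT] at h1
    have h2 := mul_left_cancel₀ hd0 (add_right_cancel h1)
    exact (Nat.pair_eq_pair.mp (by exact_mod_cast h2)).2
  · intro a
    refine (hU _).mpr ⟨?_, ?_⟩
    · rw [hAi, hAj, add_sub_cancel_left]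
      exact hw.apply_natCast_le_one.trans_lt (htw _ _)
    · rw [hAi]
      exact htw _ _
  · intro a a' h
    simp only [hAi, htT] at h
    have h2 := mul_left_cancel₀ hd0 (add_right_cancel h)
    exact Prod.ext_iff.mpr (Nat.pair_eq_pair.mp (by exact_mod_cast h2))
  · intro a P hP h
    simp only [hAi, htT] at h
    have h2 : (f.degree : ℤ) ∣ 1 :=
      (Int.dvd_add_right ⟨_, rfl⟩).mp ⟨_, h⟩
    have := Int.le_of_dvd one_pos h2
    omega

end ResidueClass

end AffineMorphism

/-! ### Monomial growth in sheared coordinates -/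

namespace AffineMorphism

section Shear

/-- The coordinate `x j - m x i`. -/
def shearCoord {R : Type*} [CommRing R] (i j : Fin 2) (m : R) (P : Fin 2 → R) : R := P j - m * P i

section Local

variable {L : Type*} [Field L] {w : AbsoluteValue L ℝ}

/-- The points with `1 < |t| < |x|`, and `|x| < |t|²` unless `e = 1`, where `x` is the `i`-th
coordinate and `t` the sheared `j`-th coordinate. -/
def shearRegion (w : AbsoluteValue L ℝ) (i j : Fin 2) (m : L) (e : ℕ) : Set (Fin 2 → L) :=
  {P | 1 < w (shearCoord i j m P) ∧ w (shearCoord i j m P) < w (P i) ∧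
    (w (P i) < w (shearCoord i j m P) ^ 2 ∨ e = 1)}

/-- In the region `shearRegion`, the map `(x, t) ↦ (t (α x + β t) + …, ρ x + …)` is a monomial map
on absolute values. -/
theorem mem_shearRegion_of_form (hw : IsNonarchimedean w) {i j : Fin 2} {m α β a b c ρ q r : L}
    {e : ℕ} (hβ : w β ≤ 1) (ha : w a ≤ 1) (hb : w b ≤ 1) (hc : w c ≤ 1) (hρ : w ρ = 1)
    (hq : w q ≤ 1) (hr : w r ≤ 1) (he : e = 1 ∧ w α = 1 ∨ e = 0 ∧ α = 0 ∧ w β = 1)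
    {P Q : Fin 2 → L} (hP : P ∈ shearRegion w i j m e)
    (hQi : Q i = shearCoord i j m P * (α * P i + β * shearCoord i j m P) +
      (a * P i + b * shearCoord i j m P + c))
    (hQt : shearCoord i j m Q = ρ * P i + q * shearCoord i j m P + r) :
    Q ∈ shearRegion w i j m e ∧
      w (Q i) = w (P i) ^ e * w (shearCoord i j m P) ^ (2 - e) ∧
      w (shearCoord i j m Q) = w (P i) := by
  obtain ⟨h1, h2, h3⟩ := hP
  set t := shearCoord i j m P with ht
  set x := P i with hx
  have hxpos : 0 < w x := by linarith
  have hle : ∀ {y z : L}, w y ≤ 1 → w (y * z) ≤ w z := fun {y z} hy => by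
    rw [map_mul]; exact mul_le_of_le_one_left (w.nonneg _) hy
  have hT : w (shearCoord i j m Q) = w x := by
    have h4 : w (ρ * x) = w x := by rw [map_mul, hρ, one_mul]
    rw [← h4]
    refine hw.apply_eq_of_sub_lt ?_
    rw [h4, hQt, show ρ * x + q * t + r - ρ * x = q * t + r by ring]
    exact hw.apply_add_lt ((hle hq).trans_lt h2) (by linarith)
  have hsmall : ∀ {B : ℝ}, w x < B → w (a * x + b * t + c) < B := fun {B} hB =>
    hw.apply_add_lt (hw.apply_add_lt ((hle ha).trans_lt hB) ((hle hb).trans_lt (h2.trans hB)))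
      (by linarith)
  -- The dominant term is `α t x` for `e = 1`, as `|t| < |x|`; for `e = 0` it is `β t ^ 2`, and the
  -- condition `|x| < |t| ^ 2` makes the affine part smaller.
  have hX : w (Q i) = w x ^ e * w t ^ (2 - e) := by
    rcases he with ⟨rfl, hα⟩ | ⟨rfl, rfl, hβ1⟩
    · have h4 : w (t * (α * x)) = w x ^ 1 * w t ^ (2 - 1) := by
        rw [map_mul, map_mul, hα]; ring
      have h5 : w x < w x ^ 1 * w t ^ (2 - 1) := by
        rw [pow_one, pow_one]; exact lt_mul_of_one_lt_right hxpos h1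
      rw [← h4]
      refine hw.apply_eq_of_sub_lt ?_
      rw [h4, hQi, show t * (α * x + β * t) + (a * x + b * t + c) - t * (α * x) =
        β * (t * t) + (a * x + b * t + c) by ring]
      refine hw.apply_add_lt ((hle hβ).trans_lt ?_) (hsmall h5)
      rw [map_mul, pow_one, pow_one]
      exact mul_lt_mul_of_pos_right h2 (by linarith)
    · have h4 : w (β * t ^ 2) = w x ^ 0 * w t ^ (2 - 0) := by
        rw [map_mul, map_pow, hβ1]; ring
      rw [← h4]
      refine hw.apply_eq_of_sub_lt ?_
      rw [h4, hQi, show t * (0 * x + β * t) + (a * x + b * t + c) - β * t ^ 2 =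
        a * x + b * t + c by ring]
      refine hsmall ?_
      rw [pow_zero, one_mul]
      exact h3.resolve_right (by norm_num)
  refine ⟨⟨?_, ?_, ?_⟩, hX, hT⟩
  · rw [hT]; linarith
  · rw [hT, hX]
    rcases he with ⟨rfl, -⟩ | ⟨rfl, -⟩
    · rw [pow_one, pow_one]; exact lt_mul_of_one_lt_right hxpos h1
    · rw [pow_zero, one_mul]; exact h3.resolve_right (by norm_num)
  · rcases he with ⟨rfl, -⟩ | ⟨rfl, -⟩
    · exact Or.inr rfl
    · left
      rw [hT, hX, pow_zero, one_mul]
      exact pow_lt_pow_left₀ h2 (by linarith) (by norm_num)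

end Local

/-- `s` is a root of the characteristic equation, so `(s ^ (n + 1), s ^ n)` solves the recurrence;
as its coefficients are nonnegative, an initial inequality persists. -/
theorem le_of_linear_recurrence {u v : ℕ → ℝ} {s : ℝ} {e : ℕ} (he : e ≤ 1) (hs : 1 < s)
    (hs2 : s ^ 2 = e * s + (2 - e)) (hu : ∀ n, u (n + 1) = e * u n + (2 - e) * v n)
    (hv : ∀ n, v (n + 1) = u n) (h0 : 0 < v 0) (huv : v 0 < u 0) :
    ∃ c, 0 < c ∧ ∀ n, c * s ^ n ≤ u n := by
  have hs0 : 0 < s := by linarith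
  have he1 : (e : ℝ) ≤ 1 := by exact_mod_cast he
  have he0 : (0 : ℝ) ≤ e := Nat.cast_nonneg _
  have key : ∀ n, v 0 / s * s ^ (n + 1) ≤ u n ∧ v 0 / s * s ^ n ≤ v n := by
    intro n
    induction n with
    | zero =>
      rw [zero_add, pow_one, div_mul_cancel₀ _ hs0.ne', pow_zero, mul_one]
      exact ⟨huv.le, (div_le_self h0.le hs.le)⟩
    | succ n ih =>
      rw [hu, hv]
      refine ⟨?_, ih.1⟩
      have e1 : v 0 / s * s ^ (n + 1 + 1) =
          e * (v 0 / s * s ^ (n + 1)) + (2 - e) * (v 0 / s * s ^ n) := by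
        rw [show s ^ (n + 1 + 1) = s ^ n * s ^ 2 by ring, hs2]; ring
      rw [e1]
      exact add_le_add (mul_le_mul_of_nonneg_left ih.1 he0)
        (mul_le_mul_of_nonneg_left ih.2 (by linarith))
  refine ⟨v 0, h0, fun n => ?_⟩
  have := (key n).1
  rwa [pow_succ', ← mul_assoc, div_mul_cancel₀ _ hs0.ne'] at this

section Global

variable {K : Type*} [Field K] {L : Type*} [Field L] [NumberField L] [Algebra K L]

open NumberField.HeightOneSpectrum in
-- The pair of pole orders of `x` and `t` evolves by the injective matrix `M`. The starting points
-- have pole orders `(2 * k + 3 + e, k + 2)` with `k = Nat.pair c n`, and such a pair is not the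
-- image under `M` of the pole orders of a point of the region.
theorem hasLargeOrbitsOver_of_shearRegion (f : AffineMorphism K) (hδ : 1 < f.dynamicalDegree)
    (p : IsDedekindDomain.HeightOneSpectrum (𝓞 L)) {i j : Fin 2} (hij : j ≠ i) {m : L} {e : ℕ}
    (he : e ≤ 1) {s : ℝ} (hs : 1 < s) (hs2 : s ^ 2 = e * s + (2 - e)) (hδs : f.dynamicalDegree ≤ s)
    (hstep : ∀ P ∈ shearRegion (adicAbv L p) i j m e,
      f.onPoints P ∈ shearRegion (adicAbv L p) i j m e ∧
      adicAbv L p (f.onPoints P i) =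
        adicAbv L p (P i) ^ e * adicAbv L p (shearCoord i j m P) ^ (2 - e) ∧
      adicAbv L p (shearCoord i j m (f.onPoints P)) = adicAbv L p (P i)) :
    f.HasLargeOrbitsOver L := by
  have hw := isNonarchimedean_adicAbv L p
  obtain ⟨ϖ, hϖ0, hϖ1, hϖ⟩ := exists_poleOrder_eq_one (L := L) p
  set R := shearRegion (adicAbv L p) i j m e with hRdef
  have ne_zero : ∀ {x : L}, 1 < adicAbv L p x → x ≠ 0 := fun {x} h h0 => by
    rw [h0, map_zero] at h
    linarith
  have hRi : ∀ P ∈ R, P i ≠ 0 := fun P hP => ne_zero (hP.1.trans hP.2.1)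
  have hRt : ∀ P ∈ R, shearCoord i j m P ≠ 0 := fun P hP => ne_zero hP.1
  have hRn : ∀ P ∈ R, ∀ n, f.onPoints^[n] P ∈ R := fun P hP n => by
    induction n with
    | zero => exact hP
    | succ n ih => rw [Function.iterate_succ_apply']; exact (hstep _ ih).1
  have hcast : ((2 - e : ℕ) : ℝ) = 2 - e := by
    push_cast [show e ≤ 2 by omega]; rfl
  let E := p.adicCompletion L
  let mE : E := algebraMap L E m
  let τ : (Fin 3 → E) → E := fun v => v j.castSucc - mE * v i.castSucc
  let a₁ : (Fin 3 → E) → E := fun v => v 2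
  let b₂ : (Fin 3 → E) → E := fun v => v i.castSucc
  -- For `e = 1` the third condition has to be void: it becomes `|τ| < |τ| ^ 2`, which follows from
  -- `1 < |τ|`.
  let a₃ : (Fin 3 → E) → E := fun v => (if e = 1 then τ v else v i.castSucc) * v 2
  let b₃ : (Fin 3 → E) → E := fun v => τ v ^ 2
  have hτ : ∀ (c : E) v, τ (c • v) = c ^ 1 * τ v := fun c v => by
    simp only [τ, Pi.smul_apply, smul_eq_mul]; ring
  have ha₁ : ∀ (c : E) v, a₁ (c • v) = c ^ 1 * a₁ v := fun c v => by
    simp only [a₁, Pi.smul_apply, smul_eq_mul]; ring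
  have hb₂ : ∀ (c : E) v, b₂ (c • v) = c ^ 1 * b₂ v := fun c v => by
    simp only [b₂, Pi.smul_apply, smul_eq_mul]; ring
  have ha₃ : ∀ (c : E) v, a₃ (c • v) = c ^ 2 * a₃ v := fun c v => by
    simp only [a₃, hτ, Pi.smul_apply, smul_eq_mul]
    split_ifs <;> ring
  have hb₃ : ∀ (c : E) v, b₃ (c • v) = c ^ 2 * b₃ v := fun c v => by
    simp only [b₃, hτ]; ring
  have hτc : Continuous τ := by fun_prop
  have ha₃c : Continuous a₃ := by
    by_cases h : e = 1
    · simp only [a₃, if_pos h]; fun_prop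
    · simp only [a₃, if_neg h]; fun_prop
  have hU : ∀ P : Fin 2 → L, toProj (fun l => algebraMap L E (P l)) ∈
      projLTSet a₁ τ ∩ (projLTSet τ b₂ ∩ projLTSet a₃ b₃) ↔ P ∈ R := by
    intro P
    have e1 : ‖τ ![algebraMap L E (P 0), algebraMap L E (P 1), 1]‖ =
        adicAbv L p (shearCoord i j m P) := by
      simp only [τ, affine_coord (fun l => algebraMap L E (P l)), mE, ← map_mul, ← map_sub,
        E, norm_algebraMap_adicCompletion, shearCoord]
    have e2 : ‖b₂ ![algebraMap L E (P 0), algebraMap L E (P 1), 1]‖ = adicAbv L p (P i) := by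
      simp only [b₂, affine_coord (fun l => algebraMap L E (P l)), E,
        norm_algebraMap_adicCompletion]
    have e3 : ‖a₁ ![algebraMap L E (P 0), algebraMap L E (P 1), 1]‖ = 1 := by simp [a₁]
    have e4 : ‖a₃ ![algebraMap L E (P 0), algebraMap L E (P 1), 1]‖ =
        if e = 1 then adicAbv L p (shearCoord i j m P) else adicAbv L p (P i) := by
      simp only [a₃]
      rw [norm_mul, show (![algebraMap L E (P 0), algebraMap L E (P 1), 1] : Fin 3 → E) 2 = 1
        from rfl, norm_one, mul_one]
      split_ifs
      · exact e1
      · exact e2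
    rw [Set.mem_inter_iff, Set.mem_inter_iff, toProj, mk_mem_projLTSet ha₁ hτ,
      mk_mem_projLTSet hτ hb₂, mk_mem_projLTSet ha₃ hb₃, e1, e2, e3, e4, norm_pow, e1]
    refine and_congr_right fun h1 => and_congr_right fun _ => ?_
    by_cases h : e = 1
    · simp only [h, if_true, or_true, iff_true]
      exact lt_self_pow₀ h1 (by norm_num)
    · simp [h]
  -- The curves are the translates of `x = κ t ^ 2`. For `e = 0` the factor `ϖ⁻¹` puts `|x|` just
  -- below `|t| ^ 2`, as the region demands, and makes the pole order of `x` odd.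
  let κ : L := ϖ⁻¹ ^ (1 - e)
  let t : ℕ → ℕ → L := fun c n => ϖ ^ (Nat.pair c n + 2)
  let A : Fin 2 → Polynomial L := fun l => if l = i then Polynomial.C κ * Polynomial.X ^ 2
    else Polynomial.X + Polynomial.C (m * κ) * Polynomial.X ^ 2
  let B : Fin 2 → L := fun l => if l = i then 1 else m
  have hAi : ∀ z c, (A i).eval z + c * B i = κ * z ^ 2 + c := fun z c => by simp [A, B]
  have hAj : ∀ z c, (A j).eval z + c * B j = z + m * (κ * z ^ 2 + c) := fun z c => by
    simp [A, B, hij]; ring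
  have hAt : ∀ z c, shearCoord i j m (fun l => (A l).eval z + c * B l) = z := fun z c => by
    rw [shearCoord, hAi, hAj]; ring
  have hκt : ∀ c n, κ * t c n ^ 2 = ϖ ^ (2 * Nat.pair c n + 3 + e) := fun c n => by
    simp only [κ, t]
    rcases (by omega : e = 0 ∨ e = 1) with rfl | rfl
    · rw [Nat.sub_zero, pow_one, inv_mul_eq_iff_eq_mul₀ hϖ0]; ring
    · ring
  have hpw : ∀ n, n ≠ 0 → 1 < adicAbv L p (ϖ ^ n) := fun n hn => by
    rw [map_pow]; exact one_lt_pow₀ hϖ hn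
  have hxw : ∀ c n, adicAbv L p (κ * t c n ^ 2 + c) =
      adicAbv L p (ϖ ^ (2 * Nat.pair c n + 3 + e)) := fun c n => by
    rw [hκt]
    refine hw.apply_eq_of_sub_lt ?_
    rw [add_sub_cancel_left]
    exact hw.apply_natCast_le_one.trans_lt (hpw _ (by omega))
  have hxT : ∀ c n, poleOrder p (κ * t c n ^ 2 + c) = 2 * Nat.pair c n + 3 + e := fun c n => by
    rw [poleOrder_congr (ne_zero (by rw [hxw]; exact hpw _ (by omega))) (pow_ne_zero _ hϖ0)
      (hxw c n), poleOrder_pow, hϖ1]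
    push_cast
    ring
  have htT : ∀ c n, poleOrder p (t c n) = Nat.pair c n + 2 := fun c n => by
    simp only [t]
    rw [poleOrder_pow, hϖ1]
    push_cast
    ring
  have hSR : ∀ a : ℕ × ℕ, (fun l => (A l).eval (t a.1 a.2) + a.1 * B l) ∈ R := fun a => by
    refine ⟨?_, ?_, ?_⟩
    · rw [hAt]; exact hpw _ (by omega)
    · simp only [hAt, hAi, hxw, t]
      rw [map_pow, map_pow]
      exact pow_lt_pow_right₀ hϖ (by omega)
    · simp only [hAt, hAi, hxw, t]
      rcases (by omega : e = 0 ∨ e = 1) with rfl | rfl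
      · left
        rw [map_pow, map_pow, ← pow_mul]
        exact pow_lt_pow_right₀ hϖ (by omega)
      · exact Or.inr rfl
  let M : ℤ × ℤ → ℤ × ℤ := fun x => (e * x.1 + (2 - e : ℕ) * x.2, x.1)
  have hM : M.Injective := by
    rintro ⟨x, y⟩ ⟨x', y'⟩ h
    simp only [M, Prod.mk.injEq] at h
    obtain ⟨h1, rfl⟩ := h
    have h2 : ((2 - e : ℕ) : ℤ) ≠ 0 := by omega
    rw [mul_left_cancel₀ h2 (add_left_cancel h1)]
  have hlt : ∀ {x y : L}, x ≠ 0 → y ≠ 0 → adicAbv L p x < adicAbv L p y →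
      poleOrder p x < poleOrder p y := fun {x y} hx hy h => by
    rw [adicAbv_eq_zpow p hx, adicAbv_eq_zpow p hy] at h
    exact (zpow_lt_zpow_iff_right₀ one_lt_absNorm_real).mp h
  refine exists_of_invariant_region f hδ p R (fun P hP => (hstep P hP).1) ?_
    (projLTSet a₁ τ ∩ (projLTSet τ b₂ ∩ projLTSet a₃ b₃)) ?_ (fun P hP => (hU P).mp hP)
    (fun P => (poleOrder p (P i), poleOrder p (shearCoord i j m P))) M hM ?_ A B ?_ t ?_
    (fun a => (hU _).mpr (hSR a)) ?_ ?_
  · intro P hP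
    obtain ⟨c, hc, h⟩ := le_of_linear_recurrence
      (u := fun n => Real.log (adicAbv L p (f.onPoints^[n] P i)))
      (v := fun n => Real.log (adicAbv L p (shearCoord i j m (f.onPoints^[n] P)))) he hs hs2
      (fun n => by
        have h1 := hRn P hP n
        rw [Function.iterate_succ_apply', (hstep _ h1).2.1, Real.log_mul, Real.log_pow,
          Real.log_pow, hcast]
        · exact pow_ne_zero _ ((map_ne_zero _).mpr (hRi _ h1))
        · exact pow_ne_zero _ ((map_ne_zero _).mpr (hRt _ h1)))
      (fun n => by
        rw [Function.iterate_succ_apply', (hstep _ (hRn P hP n)).2.2])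
      (Real.log_pos hP.1) (Real.log_lt_log (zero_lt_one.trans hP.1) hP.2.1)
    refine ⟨c, hc, fun n => ⟨i, le_trans ?_ (h n)⟩⟩
    exact mul_le_mul_of_nonneg_left (pow_le_pow_left₀ (by linarith) hδs n) hc.le
  · exact (isOpen_projLTSet ha₁ hτ (by fun_prop) hτc).inter
      ((isOpen_projLTSet hτ hb₂ hτc (by fun_prop)).inter
        (isOpen_projLTSet ha₃ hb₃ ha₃c (by fun_prop)))
  · intro P hP
    obtain ⟨h1, h2, h3⟩ := hstep P hP
    rw [← map_pow, ← map_pow, ← map_mul] at h2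
    have h4 := pow_ne_zero e (hRi P hP)
    have h5 := pow_ne_zero (2 - e) (hRt P hP)
    simp only [M]
    rw [poleOrder_congr (hRi _ h1) (mul_ne_zero h4 h5) h2, poleOrder_mul h4 h5, poleOrder_pow,
      poleOrder_pow, poleOrder_congr (hRt _ h1) (hRi P hP) h3]
  · intro Q
    refine ⟨Q j - m * Q i, Q i - κ * (Q j - m * Q i) ^ 2, ?_⟩
    rw [forall_fin_two_of_ne hij, hAi, hAj]
    exact ⟨by ring, by ring⟩
  · intro c n n' h
    have h1 := congrArg (poleOrder p) h
    rw [htT, htT] at h1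
    exact (Nat.pair_eq_pair.mp (by exact_mod_cast add_right_cancel h1)).2
  · intro a a' h
    have h1 := congrArg Prod.snd h
    simp only [hAt, htT] at h1
    exact Prod.ext_iff.mpr (Nat.pair_eq_pair.mp (by exact_mod_cast add_right_cancel h1))
  · intro a P hP h
    simp only [hAt, hAi, htT, hxT, M, Prod.mk.injEq] at h
    obtain ⟨h1, h2⟩ := h
    -- For `e = 0` the first coordinates differ in parity. For `e = 1` equality would force `x` and
    -- `t` to have equal pole orders at `P`, against `|t| < |x|`.
    have h3 := hlt (hRt P hP) (hRi P hP) hP.2.1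
    rcases (by omega : e = 0 ∨ e = 1) with rfl | rfl
    · push_cast at h1; omega
    · push_cast at h1; omega

end Global

end Shear

end AffineMorphism

/-! ### Cancellation of leading terms in total degrees -/

section TotalDegree

variable {R σ : Type*} [CommRing R]

/-- The zero polynomial has `totalDegree` equal to `0`, so "degree less than `n`" needs a separate
alternative when `n = 0`, as happens for zeroth powers below. -/
theorem totalDegree_lt_or_eq_zero_add {p q : MvPolynomial σ R} {n : ℕ}
    (hp : p = 0 ∨ p.totalDegree < n) (hq : q = 0 ∨ q.totalDegree < n) :
    p + q = 0 ∨ (p + q).totalDegree < n := by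
  rcases hp with rfl | hp
  · rwa [zero_add]
  rcases hq with rfl | hq
  · rw [add_zero]; exact Or.inr hp
  exact Or.inr ((totalDegree_add _ _).trans_lt (max_lt hp hq))

theorem totalDegree_lt_or_eq_zero_sum {ι : Type*} (s : Finset ι) {p : ι → MvPolynomial σ R} {n : ℕ}
    (hp : ∀ i ∈ s, p i = 0 ∨ (p i).totalDegree < n) :
    ∑ i ∈ s, p i = 0 ∨ (∑ i ∈ s, p i).totalDegree < n := by
  classical
  induction s using Finset.induction_on with
  | empty => simp
  | insert i s hi ih =>
    rw [Finset.sum_insert hi]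
    exact totalDegree_lt_or_eq_zero_add (hp i (Finset.mem_insert_self i s))
      (ih fun j hj => hp j (Finset.mem_insert_of_mem hj))

theorem totalDegree_lt_or_eq_zero_mul {p q : MvPolynomial σ R} {m n : ℕ}
    (hp : p.totalDegree ≤ m) (hq : q = 0 ∨ q.totalDegree < n) :
    p * q = 0 ∨ (p * q).totalDegree < m + n := by
  rcases hq with rfl | hq
  · rw [mul_zero]; exact Or.inl rfl
  · exact Or.inr ((totalDegree_mul _ _).trans_lt (by omega))

theorem totalDegree_lt_or_eq_zero_mul_sub_mul {p p' q q' : MvPolynomial σ R} {m n : ℕ}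
    (hp : p.totalDegree ≤ m) (hq' : q'.totalDegree ≤ n)
    (hpp : p - p' = 0 ∨ (p - p').totalDegree < m) (hqq : q - q' = 0 ∨ (q - q').totalDegree < n) :
    p * q - p' * q' = 0 ∨ (p * q - p' * q').totalDegree < m + n := by
  have e : p * q - p' * q' = p * (q - q') + q' * (p - p') := by ring
  rw [e]
  refine totalDegree_lt_or_eq_zero_add (totalDegree_lt_or_eq_zero_mul hp hqq) ?_
  rw [add_comm m n]
  exact totalDegree_lt_or_eq_zero_mul hq' hpp

theorem totalDegree_lt_or_eq_zero_pow_sub_pow {p p' : MvPolynomial σ R} {m : ℕ}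
    (hp : p.totalDegree ≤ m) (hp' : p'.totalDegree ≤ m)
    (hpp : p - p' = 0 ∨ (p - p').totalDegree < m) (n : ℕ) :
    p ^ n - p' ^ n = 0 ∨ (p ^ n - p' ^ n).totalDegree < n * m := by
  induction n with
  | zero => simp
  | succ n ih =>
    rw [pow_succ, pow_succ, add_mul, one_mul]
    exact totalDegree_lt_or_eq_zero_mul_sub_mul
      ((totalDegree_pow _ _).trans (Nat.mul_le_mul_left _ hp)) hp' ih hpp

theorem totalDegree_C_mul_le (a : R) (p : MvPolynomial σ R) :
    (C a * p).totalDegree ≤ p.totalDegree :=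
  (totalDegree_mul _ _).trans (by rw [totalDegree_C, zero_add])

theorem totalDegree_linear_comb_le (x t : MvPolynomial σ R) (a b c : R) :
    (C a * x + C b * t + C c).totalDegree ≤ max x.totalDegree t.totalDegree := by
  refine (totalDegree_add _ _).trans (max_le ((totalDegree_add _ _).trans (max_le ?_ ?_)) ?_)
  · exact (totalDegree_C_mul_le a x).trans (le_max_left _ _)
  · exact (totalDegree_C_mul_le b t).trans (le_max_right _ _)
  · rw [totalDegree_C]; exact Nat.zero_le _

theorem totalDegree_lt_or_eq_zero_of_homogeneousComponent_eq_zero {g : MvPolynomial σ R} {d : ℕ}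
    (hg : g.totalDegree ≤ d) (h0 : homogeneousComponent d g = 0) :
    g = 0 ∨ g.totalDegree < d := by
  by_contra! h
  have hd : g.totalDegree = d := le_antisymm hg h.2
  obtain ⟨s, hs, hsd⟩ := Finset.exists_mem_eq_sup g.support (support_nonempty.mpr h.1)
    fun s => s.sum fun _ e => e
  have h1 := congrArg (coeff s) h0
  rw [coeff_homogeneousComponent, coeff_zero, if_pos] at h1
  · exact mem_support_iff.mp hs h1
  · rw [← hd, totalDegree, hsd]
    rfl

end TotalDegree

namespace AffineMorphism

/-! ### Degree drop under composition -/

section LeadingForms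

variable {K : Type*} [Field K]

theorem homogeneousComponent_sub_leadingForm (f : AffineMorphism K) (l : Fin 2) :
    f l - f.leadingForm l = 0 ∨ (f l - f.leadingForm l).totalDegree < f.degree := by
  refine totalDegree_lt_or_eq_zero_of_homogeneousComponent_eq_zero
    ((totalDegree_sub _ _).trans (max_le (totalDegree_le_degree f l) ?_)) ?_
  · exact (homogeneousComponent_isHomogeneous _ _).totalDegree_le
  · rw [map_sub, leadingForm,
      homogeneousComponent_of_mem (homogeneousComponent_isHomogeneous f.degree (f l)), if_pos rfl,
      sub_self]

theorem sub_C_mul_of_leadingForm_eq {f : AffineMorphism K} {i j : Fin 2} {m : K}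
    (hF : f.leadingForm j = C m * f.leadingForm i) :
    f j - C m * f i = 0 ∨ (f j - C m * f i).totalDegree < f.degree := by
  refine totalDegree_lt_or_eq_zero_of_homogeneousComponent_eq_zero
    ((totalDegree_sub _ _).trans (max_le (totalDegree_le_degree f j)
      ((totalDegree_C_mul_le _ _).trans (totalDegree_le_degree f i)))) ?_
  rw [map_sub, homogeneousComponent_C_mul]
  exact sub_eq_zero.mpr hF

theorem bind₁_smul_of_isHomogeneous {R σ τ : Type*} [CommRing R] [Fintype σ]
    {F : MvPolynomial σ R} {d : ℕ} (hF : F.IsHomogeneous d) (v : σ → R) (y : MvPolynomial τ R) :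
    bind₁ (fun l => C (v l) * y) F = C (eval v F) * y ^ d := by
  rw [F.as_sum, map_sum, map_sum, map_sum, Finset.sum_mul]
  refine Finset.sum_congr rfl fun s hs => ?_
  have h := hF.degree_eq_sum_deg_support hs
  rw [bind₁_monomial, eval_monomial, Finsupp.prod_fintype _ _ (by simp), map_mul, map_prod]
  rw [Finset.prod_subset (Finset.subset_univ s.support) (by
    intro l _ hl
    rw [Finsupp.notMem_support_iff.mp hl, pow_zero])]
  rw [h, Finset.sum_subset (Finset.subset_univ s.support) (by
    intro l _ hl
    exact Finsupp.notMem_support_iff.mp hl), ← Finset.prod_pow_eq_pow_sum]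
  simp only [mul_pow, Finset.prod_mul_distrib, map_pow]
  ring

/-- If the line at infinity is contracted to an indeterminacy point then the degree drops. -/
theorem degree_comp_self_lt {f : AffineMorphism K} (hd : f.degree ≠ 0) {i j : Fin 2} (hij : j ≠ i)
    {m : K} (hF : f.leadingForm j = C m * f.leadingForm i)
    (hm : eval (slopeVec i m) (f.leadingForm i) = 0) :
    (comp f f).degree < f.degree * f.degree := by
  have hm' : ∀ l, eval (slopeVec i m) (f.leadingForm l) = 0 := by
    rw [forall_fin_two_of_ne hij]
    exact ⟨hm, by rw [hF, map_mul, hm, mul_zero]⟩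
  have hpos : 0 < f.degree * f.degree := by positivity
  -- Modulo lower degree `f` is `f i` times the constant vector of slope `m`. By homogeneity the
  -- leading forms vanish identically on this approximation, so nothing of degree `d * d` survives
  -- in `comp f f`.
  let f' : AffineMorphism K := fun l => C (slopeVec i m l) * f i
  have hf' : ∀ l, (f' l).totalDegree ≤ f.degree := fun l =>
    (totalDegree_C_mul_le _ _).trans (totalDegree_le_degree f i)
  have hff' : ∀ l, f l - f' l = 0 ∨ (f l - f' l).totalDegree < f.degree := by
    rw [forall_fin_two_of_ne hij]
    simp only [f', slopeVec_self, slopeVec_of_ne hij, map_one, one_mul, sub_self]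
    exact ⟨Or.inl trivial, sub_C_mul_of_leadingForm_eq hF⟩
  have hlead : ∀ l, bind₁ f (f.leadingForm l) = 0 ∨
      (bind₁ f (f.leadingForm l)).totalDegree < f.degree * f.degree := by
    intro l
    have hhom : (f.leadingForm l).IsHomogeneous f.degree := homogeneousComponent_isHomogeneous _ _
    have h0 : bind₁ f' (f.leadingForm l) = 0 := by
      rw [bind₁_smul_of_isHomogeneous hhom, hm', map_zero, zero_mul]
    have h1 : bind₁ f (f.leadingForm l) =
        bind₁ f (f.leadingForm l) - bind₁ f' (f.leadingForm l) := by rw [h0, sub_zero]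
    rw [h1, (f.leadingForm l).as_sum, map_sum, map_sum, ← Finset.sum_sub_distrib]
    refine totalDegree_lt_or_eq_zero_sum _ fun s hs => ?_
    have hs' := hhom.degree_eq_sum_deg_support hs
    rw [Finset.sum_subset (Finset.subset_univ s.support) (by
      intro l _ hl
      exact Finsupp.notMem_support_iff.mp hl), Fin.sum_univ_two] at hs'
    have e : ∀ g : AffineMorphism K, bind₁ g (monomial s (coeff s (f.leadingForm l))) =
        C (coeff s (f.leadingForm l)) * (g 0 ^ s 0 * g 1 ^ s 1) := fun g => by
      rw [bind₁_monomial, Finset.prod_subset (Finset.subset_univ s.support) (by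
        intro l _ hl
        rw [Finsupp.notMem_support_iff.mp hl, pow_zero]), Fin.prod_univ_two]
    rw [e, e, ← mul_sub]
    have := totalDegree_lt_or_eq_zero_mul (totalDegree_C (coeff s (f.leadingForm l))).le
      (totalDegree_lt_or_eq_zero_mul_sub_mul
        ((totalDegree_pow (f 0) (s 0)).trans (Nat.mul_le_mul_left _ (totalDegree_le_degree f 0)))
        ((totalDegree_pow (f' 1) (s 1)).trans (Nat.mul_le_mul_left _ (hf' 1)))
        (totalDegree_lt_or_eq_zero_pow_sub_pow (totalDegree_le_degree f 0) (hf' 0) (hff' 0) (s 0))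
        (totalDegree_lt_or_eq_zero_pow_sub_pow (totalDegree_le_degree f 1) (hf' 1) (hff' 1) (s 1)))
    rwa [zero_add, ← add_mul, ← hs'] at this
  have hall : ∀ l, (bind₁ f (f l)).totalDegree < f.degree * f.degree := by
    intro l
    have h1 : bind₁ f (f l - f.leadingForm l) = 0 ∨
        (bind₁ f (f l - f.leadingForm l)).totalDegree < f.degree * f.degree := by
      rcases homogeneousComponent_sub_leadingForm f l with h | h
      · rw [h, map_zero]; exact Or.inl rfl
      · exact Or.inr ((totalDegree_bind₁_le f _).trans_lt
          (Nat.mul_lt_mul_of_pos_right h (by omega)))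
    have h2 := totalDegree_lt_or_eq_zero_add h1 (hlead l)
    rw [← map_add, sub_add_cancel] at h2
    rcases h2 with h2 | h2
    · rw [h2, totalDegree_zero]; exact hpos
    · exact h2
  exact max_lt (hall 0) (hall 1)

theorem iterate_two (f : AffineMorphism K) : f.iterate 2 = comp f f := by
  have h1 : f.iterate 1 = f := by
    ext1 i
    simp only [iterate, comp]
    exact aeval_X_left_apply _
  rw [iterate, h1]

theorem AlgebraicallyStable.degree_comp_self {f : AffineMorphism K} (hf : f.AlgebraicallyStable) :
    (comp f f).degree = f.degree * f.degree := by
  have h := LinearMap.congr_fun (hf 2 one_le_two) 1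
  rw [iterate_two, sq, Module.End.mul_apply] at h
  simp only [pullbackNS, LinearMap.smul_apply, LinearMap.id_apply, smul_eq_mul, mul_one] at h
  exact_mod_cast h.symm

end LeadingForms

end AffineMorphism

/-! ### Primes of good reduction -/

section GoodPrime

/-- Take a prime above a rational prime `ℓ` larger than the norm of `n`: if it contained `n`, it
would contain this norm and `ℓ`, which are coprime. -/
theorem exists_heightOneSpectrum_notMem {K : Type*} [Field K] [NumberField K] {n : 𝓞 K}
    (hn : n ≠ 0) : ∃ p : IsDedekindDomain.HeightOneSpectrum (𝓞 K), n ∉ p.asIdeal := by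
  set N := Ideal.absNorm (Ideal.span {n}) with hN
  have hN0 : N ≠ 0 := by
    rw [hN, Ne, Ideal.absNorm_eq_zero_iff, Ideal.span_singleton_eq_bot]
    exact hn
  obtain ⟨ℓ, hℓN, hℓ⟩ := Nat.exists_infinite_primes (N + 1)
  have hne : Ideal.span {(ℓ : 𝓞 K)} ≠ ⊤ := by
    rw [Ne, ← Ideal.absNorm_eq_one_iff, Ideal.absNorm_span_natCast]
    exact (Nat.one_lt_pow Module.finrank_pos.ne' hℓ.one_lt).ne'
  obtain ⟨P, hP, hle⟩ := Ideal.exists_le_maximal _ hne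
  have hℓP : (ℓ : 𝓞 K) ∈ P := hle (Ideal.mem_span_singleton_self _)
  refine ⟨⟨P, hP.isPrime, ?_⟩, fun hnP => ?_⟩
  · rintro rfl
    exact hℓ.ne_zero (Nat.cast_eq_zero.mp ((Submodule.mem_bot _).mp hℓP))
  · have hNP : (N : 𝓞 K) ∈ P :=
      (Ideal.span_singleton_le_iff_mem _).mpr hnP (Ideal.absNorm_mem _)
    have hcop : Nat.Coprime ℓ N := Nat.coprime_of_lt_prime hN0 (by omega) hℓ
    obtain ⟨u, v, huv⟩ := Nat.isCoprime_iff_coprime.mpr hcop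
    refine hP.ne_top ((Ideal.eq_top_iff_one _).mpr ?_)
    have h1 : (u : 𝓞 K) * (ℓ : 𝓞 K) + (v : 𝓞 K) * (N : 𝓞 K) = 1 := by
      exact_mod_cast congrArg (Int.cast : ℤ → 𝓞 K) huv
    rw [← h1]
    exact P.add_mem (P.mul_mem_left _ hℓP) (P.mul_mem_left _ hNP)

open NumberField.HeightOneSpectrum in
-- The product of all numerators and denominators works. It does not depend on `L`, so the prime can
-- be chosen in `K` before the extension is known.
theorem exists_adicAbv_eq_one_of_notMem {K : Type*} [Field K] [NumberField K] (s : Finset K) :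
    ∃ n : 𝓞 K, n ≠ 0 ∧ ∀ (L : Type*) [Field L] [NumberField L] [Algebra K L]
      (p : IsDedekindDomain.HeightOneSpectrum (𝓞 L)), algebraMap (𝓞 K) (𝓞 L) n ∉ p.asIdeal →
      ∀ x ∈ s, x ≠ 0 → adicAbv L p (algebraMap K L x) = 1 := by
  classical
  induction s using Finset.induction_on with
  | empty => exact ⟨1, one_ne_zero, by simp⟩
  | insert x s _ ih =>
    obtain ⟨n, hn, H⟩ := ih
    by_cases hx : x = 0
    · refine ⟨n, hn, fun L _ _ _ p hp y hy hy0 => ?_⟩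
      rcases Finset.mem_insert.mp hy with rfl | hy
      · exact absurd hx hy0
      · exact H L p hp y hy hy0
    obtain ⟨a, b, hb, rfl⟩ := IsFractionRing.div_surjective (A := 𝓞 K) x
    have hb0 : b ≠ 0 := nonZeroDivisors.ne_zero hb
    have ha0 : a ≠ 0 := by
      rintro rfl
      simp at hx
    refine ⟨n * (a * b), mul_ne_zero hn (mul_ne_zero ha0 hb0), fun L _ _ _ p hp y hy hy0 => ?_⟩
    rw [map_mul, map_mul] at hp
    rcases Finset.mem_insert.mp hy with rfl | hy
    · have h1 : ∀ c : 𝓞 K, algebraMap (𝓞 K) (𝓞 L) c ∉ p.asIdeal →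
          adicAbv L p (algebraMap K L (algebraMap (𝓞 K) K c)) = 1 := fun c hc => by
        have e : algebraMap K L (algebraMap (𝓞 K) K c) =
          algebraMap (𝓞 L) L (algebraMap (𝓞 K) (𝓞 L) c) := rfl
        rw [e, ← FinitePlace.norm_embedding]
        exact (FinitePlace.norm_eq_one_iff_notMem L p _).mpr hc
      rw [map_div₀, map_div₀,
        h1 a fun h => hp (Ideal.mul_mem_left _ _ (Ideal.mul_mem_right _ _ h)),
        h1 b fun h => hp (Ideal.mul_mem_left _ _ (Ideal.mul_mem_left _ _ h)), div_one]
    · exact H L p (fun h => hp (Ideal.mul_mem_right _ _ h)) y hy hy0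

end GoodPrime

namespace AffineMorphism

/-! ### Quadratic maps that contract the line at infinity to an indeterminacy point -/

section Quadratic

variable {K : Type*} [Field K]

theorem monomial_eq_of_ne {i j : Fin 2} (hij : j ≠ i) (s : Fin 2 →₀ ℕ) (c : K) :
    monomial s c = C c * (X i ^ s i * X j ^ s j) := by
  rw [monomial_eq, Finsupp.prod_fintype _ _ (by simp), Fin.prod_univ_two]
  rcases (by omega : i = 0 ∧ j = 1 ∨ i = 1 ∧ j = 0) with ⟨rfl, rfl⟩ | ⟨rfl, rfl⟩
  · rfl
  · rw [mul_comm (X 0 ^ s 0)]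

theorem add_le_of_mem_support {i j : Fin 2} (hij : j ≠ i) {g : MvPolynomial (Fin 2) K} {N : ℕ}
    (hg : g.totalDegree ≤ N) {s : Fin 2 →₀ ℕ} (hs : s ∈ g.support) : s i + s j ≤ N := by
  have h := le_of_mem_support hg hs
  rcases (by omega : i = 0 ∧ j = 1 ∨ i = 1 ∧ j = 0) with ⟨rfl, rfl⟩ | ⟨rfl, rfl⟩ <;> omega

theorem exists_linear_of_totalDegree_le {i j : Fin 2} (hij : j ≠ i) {g : MvPolynomial (Fin 2) K}
    (hg : g.totalDegree ≤ 1) : ∃ a b c : K, g = C a * X i + C b * X j + C c := by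
  have h : ∀ S ⊆ g.support, ∃ a b c : K,
      ∑ s ∈ S, monomial s (g.coeff s) = C a * X i + C b * X j + C c := by
    classical
    intro S
    induction S using Finset.induction_on with
    | empty => exact fun _ => ⟨0, 0, 0, by simp⟩
    | insert s S hs ih =>
      intro hS
      obtain ⟨a, b, c, h⟩ := ih ((Finset.subset_insert s S).trans hS)
      have hs' := add_le_of_mem_support hij hg (hS (Finset.mem_insert_self s S))
      rw [Finset.sum_insert hs, h, monomial_eq_of_ne hij]
      rcases (by omega : s i = 0 ∧ s j = 0 ∨ s i = 1 ∧ s j = 0 ∨ s i = 0 ∧ s j = 1) with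
        ⟨h1, h2⟩ | ⟨h1, h2⟩ | ⟨h1, h2⟩ <;> rw [h1, h2]
      · exact ⟨a, b, c + g.coeff s, by simp only [map_add]; ring⟩
      · exact ⟨a + g.coeff s, b, c, by simp only [map_add]; ring⟩
      · exact ⟨a, b + g.coeff s, c, by simp only [map_add]; ring⟩
  rw [g.as_sum]
  exact h _ subset_rfl

theorem exists_quadratic_of_totalDegree_le {i j : Fin 2} (hij : j ≠ i) {g : MvPolynomial (Fin 2) K}
    (hg : g.totalDegree ≤ 2) : ∃ a b c d e k : K, g = C a * X i ^ 2 + C b * (X i * X j) +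
      C c * X j ^ 2 + (C d * X i + C e * X j + C k) := by
  have h : ∀ S ⊆ g.support, ∃ a b c d e k : K, ∑ s ∈ S, monomial s (g.coeff s) =
      C a * X i ^ 2 + C b * (X i * X j) + C c * X j ^ 2 + (C d * X i + C e * X j + C k) := by
    classical
    intro S
    induction S using Finset.induction_on with
    | empty => exact fun _ => ⟨0, 0, 0, 0, 0, 0, by simp⟩
    | insert s S hs ih =>
      intro hS
      obtain ⟨a, b, c, d, e, k, h⟩ := ih ((Finset.subset_insert s S).trans hS)
      have hs' := add_le_of_mem_support hij hg (hS (Finset.mem_insert_self s S))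
      rw [Finset.sum_insert hs, h, monomial_eq_of_ne hij]
      rcases (by omega : s i = 0 ∧ s j = 0 ∨ s i = 1 ∧ s j = 0 ∨ s i = 0 ∧ s j = 1 ∨
        s i = 2 ∧ s j = 0 ∨ s i = 1 ∧ s j = 1 ∨ s i = 0 ∧ s j = 2) with
        ⟨h1, h2⟩ | ⟨h1, h2⟩ | ⟨h1, h2⟩ | ⟨h1, h2⟩ | ⟨h1, h2⟩ | ⟨h1, h2⟩ <;> rw [h1, h2]
      · exact ⟨a, b, c, d, e, k + g.coeff s, by simp only [map_add]; ring⟩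
      · exact ⟨a, b, c, d + g.coeff s, e, k, by simp only [map_add]; ring⟩
      · exact ⟨a, b, c, d, e + g.coeff s, k, by simp only [map_add]; ring⟩
      · exact ⟨a + g.coeff s, b, c, d, e, k, by simp only [map_add]; ring⟩
      · exact ⟨a, b + g.coeff s, c, d, e, k, by simp only [map_add]; ring⟩
      · exact ⟨a, b, c + g.coeff s, d, e, k, by simp only [map_add]; ring⟩
  rw [g.as_sum]
  exact h _ subset_rfl

/-- The quadratic form vanishes at slope `m`, so it is divisible by `t = X j - m * X i`, and the
leading terms cancel in `f j - m * f i`. -/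
theorem exists_shear_form {f : AffineMorphism K} (hd : f.degree = 2) {i j : Fin 2} (hij : j ≠ i)
    {m : K} (hF : f.leadingForm j = C m * f.leadingForm i) (h0 : f.leadingForm i ≠ 0)
    (hm : eval (slopeVec i m) (f.leadingForm i) = 0) :
    ∃ α β a b c ρ q r : K, (α ≠ 0 ∨ α = 0 ∧ β ≠ 0) ∧
      f i = (X j - C m * X i) * (C α * X i + C β * (X j - C m * X i)) +
        (C a * X i + C b * (X j - C m * X i) + C c) ∧
      f j - C m * f i = C ρ * X i + C q * (X j - C m * X i) + C r := by
  have hi : (f i).totalDegree ≤ 2 := (totalDegree_le_degree f i).trans hd.le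
  obtain ⟨a₂, b₂, c₂, a₁, b₁, c₁, hfi⟩ := exists_quadratic_of_totalDegree_le hij hi
  have hlin : (f j - C m * f i).totalDegree ≤ 1 := by
    rcases sub_C_mul_of_leadingForm_eq hF with h | h
    · rw [h, totalDegree_zero]; exact Nat.zero_le _
    · omega
  obtain ⟨ρ, q, r, hfj⟩ := exists_linear_of_totalDegree_le hij hlin
  have hlead : f.leadingForm i = C a₂ * X i ^ 2 + C b₂ * (X i * X j) + C c₂ * X j ^ 2 := by
    have hX : ∀ l l' : Fin 2, (X l * X l' : MvPolynomial (Fin 2) K).IsHomogeneous 2 :=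
      fun l l' => (isHomogeneous_X K l).mul (isHomogeneous_X K l')
    have h2 : (C a₂ * X i ^ 2 + C b₂ * (X i * X j) + C c₂ * X j ^ 2 :
        MvPolynomial (Fin 2) K).IsHomogeneous 2 := by
      rw [sq, sq]
      exact (((hX i i).C_mul a₂).add ((hX i j).C_mul b₂)).add ((hX j j).C_mul c₂)
    have h1 : (C a₁ * X i + C b₁ * X j + C c₁ : MvPolynomial (Fin 2) K).totalDegree < 2 :=
      (totalDegree_linear_comb_le _ _ _ _ _).trans_lt (by simp)
    rw [leadingForm, hd, hfi, map_add, homogeneousComponent_eq_zero _ _ h1, add_zero,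
      homogeneousComponent_of_mem h2, if_pos rfl]
  rw [hlead] at hm
  simp only [map_add, map_mul, map_pow, eval_C, eval_X, slopeVec_self, slopeVec_of_ne hij] at hm
  -- The coefficients after the substitution `X j = t + m * X i`; that of `X i ^ 2` is zero by `hm`.
  refine ⟨b₂ + 2 * c₂ * m, c₂, a₁ + b₁ * m, b₁, c₁, ρ + q * m, q, r, ?_, ?_, ?_⟩
  · by_contra! h
    have hc : c₂ = 0 := by
      by_contra hc
      exact hc (h.2 h.1)
    have hb : b₂ = 0 := by simpa [hc] using h.1
    have ha : a₂ = 0 := by simpa [hc, hb] using hm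
    exact h0 (by simp [hlead, ha, hb, hc])
  · have e : a₂ = -(b₂ * m + c₂ * m ^ 2) := by linear_combination hm
    rw [hfi, e]
    simp only [map_add, map_mul, map_neg, map_pow, map_ofNat]
    ring
  · rw [hfj]
    simp only [map_add, map_mul]
    ring

theorem degree_iterate_le_max (f : AffineMorphism K) {i j : Fin 2} (hij : j ≠ i) (m : K) (n : ℕ) :
    (f.iterate n).degree ≤ max (f.iterate n i).totalDegree
      (f.iterate n j - C m * f.iterate n i).totalDegree := by
  have h : ∀ l, (f.iterate n l).totalDegree ≤ max (f.iterate n i).totalDegree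
      (f.iterate n j - C m * f.iterate n i).totalDegree := by
    rw [forall_fin_two_of_ne hij]
    refine ⟨le_max_left _ _, ?_⟩
    have e : f.iterate n j = C m * f.iterate n i + C 1 * (f.iterate n j - C m * f.iterate n i) +
        C 0 := by simp
    calc (f.iterate n j).totalDegree = _ := congrArg totalDegree e
      _ ≤ _ := totalDegree_linear_comb_le _ _ _ _ _
  exact max_le (h 0) (h 1)

section ShearForm

variable {f : AffineMorphism K} {i j : Fin 2} {m α β a b c ρ q r : K}

/-- The summand `C 0` gives the second factor the shape required by `totalDegree_linear_comb_le`. -/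
theorem iterate_succ_of_shear_form
    (hfi : f i = (X j - C m * X i) * (C α * X i + C β * (X j - C m * X i)) +
      (C a * X i + C b * (X j - C m * X i) + C c))
    (hfj : f j - C m * f i = C ρ * X i + C q * (X j - C m * X i) + C r) (n : ℕ) :
    f.iterate (n + 1) i = (f.iterate n j - C m * f.iterate n i) *
        (C α * f.iterate n i + C β * (f.iterate n j - C m * f.iterate n i) + C 0) +
        (C a * f.iterate n i + C b * (f.iterate n j - C m * f.iterate n i) + C c) ∧
      f.iterate (n + 1) j - C m * f.iterate (n + 1) i = C ρ * f.iterate n i +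
        C q * (f.iterate n j - C m * f.iterate n i) + C r := by
  constructor
  · simp only [iterate, comp]
    rw [hfi]
    simp
  · have e : f.iterate (n + 1) j - C m * f.iterate (n + 1) i =
        bind₁ (f.iterate n) (f j - C m * f i) := by
      simp [iterate, comp]
    rw [e, hfj]
    simp

/-- The degrees of `x` and `t` under iteration obey, as inequalities, the recurrence of the monomial
map, so they stay below its solution `(s ^ (n + 1), s ^ n)`. -/
theorem dynamicalDegree_le_of_shear_form (hij : j ≠ i)
    (hfi : f i = (X j - C m * X i) * (C α * X i + C β * (X j - C m * X i)) +
      (C a * X i + C b * (X j - C m * X i) + C c))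
    (hfj : f j - C m * f i = C ρ * X i + C q * (X j - C m * X i) + C r)
    {e : ℕ} (he : e = 1 ∨ e = 0 ∧ α = 0) {s : ℝ} (hs : 1 < s) (hs2 : s ^ 2 = e * s + (2 - e)) :
    f.dynamicalDegree ≤ s := by
  have hrec := iterate_succ_of_shear_form hfi hfj
  set x : ℕ → MvPolynomial (Fin 2) K := fun n => f.iterate n i with hx
  set t : ℕ → MvPolynomial (Fin 2) K := fun n => f.iterate n j - C m * f.iterate n i with ht
  have h0 : (x 0).totalDegree ≤ 1 ∧ (t 0).totalDegree ≤ 1 := by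
    have hX : ∀ l : Fin 2, (X l : MvPolynomial (Fin 2) K).totalDegree ≤ 1 := fun l => by simp
    refine ⟨hX i, (totalDegree_sub _ _).trans (max_le (hX j) ?_)⟩
    exact (totalDegree_C_mul_le _ _).trans (hX i)
  have key : ∀ n, ((x n).totalDegree : ℝ) ≤ s ^ (n + 1) ∧ ((t n).totalDegree : ℝ) ≤ s ^ n := by
    intro n
    induction n with
    | zero =>
      have h1 : ((x 0).totalDegree : ℝ) ≤ 1 := by exact_mod_cast h0.1
      have h2 : ((t 0).totalDegree : ℝ) ≤ 1 := by exact_mod_cast h0.2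
      rw [zero_add, pow_one, pow_zero]
      exact ⟨h1.trans hs.le, h2⟩
    | succ n ih =>
      obtain ⟨hx1, ht1⟩ := ih
      have hsn : s ^ n ≤ s ^ (n + 1) := pow_le_pow_right₀ hs.le (by omega)
      have hsn' : s ^ (n + 1) ≤ s ^ (n + 1 + 1) := pow_le_pow_right₀ hs.le (by omega)
      have hlin : ∀ a' b' c' : K, ((C a' * x n + C b' * t n + C c').totalDegree : ℝ) ≤
          s ^ (n + 1) := fun a' b' c' => by
        have h := totalDegree_linear_comb_le (x n) (t n) a' b' c'
        calc ((C a' * x n + C b' * t n + C c').totalDegree : ℝ)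
            ≤ (max (x n).totalDegree (t n).totalDegree : ℕ) := by exact_mod_cast h
          _ ≤ s ^ (n + 1) := by rw [Nat.cast_max]; exact max_le hx1 (ht1.trans hsn)
      refine ⟨?_, ?_⟩
      · have e1 : x (n + 1) = t n * (C α * x n + C β * t n + C 0) +
            (C a * x n + C b * t n + C c) := (hrec n).1
        have e2 : s ^ (n + 1 + 1) = e * s ^ (n + 1) + (2 - e) * s ^ n := by
          rw [show s ^ (n + 1 + 1) = s ^ n * s ^ 2 by ring, hs2]; ring
        have hmul : ((t n * (C α * x n + C β * t n + C 0)).totalDegree : ℝ) ≤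
            s ^ (n + 1 + 1) := by
          have h := totalDegree_mul (t n) (C α * x n + C β * t n + C 0)
          have h' : ((t n * (C α * x n + C β * t n + C 0)).totalDegree : ℝ) ≤
            (t n).totalDegree + (C α * x n + C β * t n + C 0).totalDegree := by exact_mod_cast h
          refine h'.trans ?_
          rw [e2]
          rcases he with rfl | ⟨rfl, rfl⟩
          · have := hlin α β 0
            push_cast
            linarith
          · have h3 : ((C 0 * x n + C β * t n + C 0).totalDegree : ℝ) ≤ (t n).totalDegree := by
              have := totalDegree_C_mul_le β (t n)
              simp only [map_zero, zero_mul, zero_add, add_zero]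
              exact_mod_cast this
            push_cast
            linarith
        rw [e1]
        calc _ ≤ ((max (t n * (C α * x n + C β * t n + C 0)).totalDegree
              (C a * x n + C b * t n + C c).totalDegree : ℕ) : ℝ) := by
                exact_mod_cast totalDegree_add _ _
          _ ≤ s ^ (n + 1 + 1) := by
                rw [Nat.cast_max]; exact max_le hmul ((hlin a b c).trans hsn')
      · have e1 : t (n + 1) = C ρ * x n + C q * t n + C r := (hrec n).2
        rw [e1]
        exact hlin ρ q r
  refine dynamicalDegree_le_of_degree_le f (A := s) (by linarith) (by linarith) fun n => ?_
  have h1 := degree_iterate_le_max f hij m (n + 1)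
  calc ((f.iterate (n + 1)).degree : ℝ)
      ≤ ((max (x (n + 1)).totalDegree (t (n + 1)).totalDegree : ℕ) : ℝ) := by exact_mod_cast h1
    _ ≤ s ^ (n + 1 + 1) := by
        rw [Nat.cast_max]
        exact max_le (key _).1 ((key _).2.trans (pow_le_pow_right₀ hs.le (by omega)))
    _ = s * s ^ (n + 1) := by ring

/-- With `ρ = 0` the coordinate `t` evolves by an affine map of the line and keeps degree at most
one, so each step raises the degree of `x` by at most one: growth is linear. -/
theorem dynamicalDegree_le_one_of_shear_form (hij : j ≠ i)
    (hfi : f i = (X j - C m * X i) * (C α * X i + C β * (X j - C m * X i)) +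
      (C a * X i + C b * (X j - C m * X i) + C c))
    (hfj : f j - C m * f i = C 0 * X i + C q * (X j - C m * X i) + C r) :
    f.dynamicalDegree ≤ 1 := by
  have hrec := iterate_succ_of_shear_form hfi hfj
  set x : ℕ → MvPolynomial (Fin 2) K := fun n => f.iterate n i with hx
  set t : ℕ → MvPolynomial (Fin 2) K := fun n => f.iterate n j - C m * f.iterate n i with ht
  have h0 : (x 0).totalDegree ≤ 1 ∧ (t 0).totalDegree ≤ 1 := by
    have hX : ∀ l : Fin 2, (X l : MvPolynomial (Fin 2) K).totalDegree ≤ 1 := fun l => by simp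
    refine ⟨hX i, (totalDegree_sub _ _).trans (max_le (hX j) ?_)⟩
    exact (totalDegree_C_mul_le _ _).trans (hX i)
  have key : ∀ n, (x n).totalDegree ≤ n + 1 ∧ (t n).totalDegree ≤ 1 := by
    intro n
    induction n with
    | zero => exact h0
    | succ n ih =>
      have e1 : x (n + 1) = t n * (C α * x n + C β * t n + C 0) +
          (C a * x n + C b * t n + C c) := (hrec n).1
      have e2 : t (n + 1) = C 0 * x n + C q * t n + C r := (hrec n).2
      have hlin := totalDegree_linear_comb_le (x n) (t n)
      constructor
      · rw [e1]
        have h1 := totalDegree_mul (t n) (C α * x n + C β * t n + C 0)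
        have h2 := hlin α β 0
        have h3 := hlin a b c
        refine (totalDegree_add _ _).trans (max_le ?_ ?_) <;> omega
      · have h3 := totalDegree_linear_comb_le (t n) (t n) 0 q r
        rw [e2, map_zero, zero_mul]
        rw [map_zero, zero_mul] at h3
        omega
  refine le_of_forall_gt_imp_ge_of_dense fun s hs => ?_
  have hs1 : 0 < s - 1 := by linarith
  -- By Bernoulli `s ^ (n + 1) ≥ 1 + (n + 1) * (s - 1)`, and this constant makes the product at
  -- least `n + 2`.
  refine dynamicalDegree_le_of_degree_le f (A := 1 + 1 / (s - 1)) (by positivity) (by linarith)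
    fun n => ?_
  have h1 := degree_iterate_le_max f hij m (n + 1)
  have h2 : (f.iterate (n + 1)).degree ≤ n + 2 := h1.trans (max_le (key _).1
    ((key _).2.trans (by omega)))
  have h3 := one_add_mul_le_pow (a := s - 1) (by linarith) (n + 1)
  rw [add_sub_cancel] at h3
  calc ((f.iterate (n + 1)).degree : ℝ) ≤ n + 2 := by exact_mod_cast h2
    _ ≤ (1 + 1 / (s - 1)) * (1 + ((n + 1 : ℕ) : ℝ) * (s - 1)) := by
        have e : (1 + 1 / (s - 1)) * (1 + ((n + 1 : ℕ) : ℝ) * (s - 1)) =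
            n + 2 + (((n + 1 : ℕ) : ℝ) * (s - 1) + 1 / (s - 1)) := by
          field_simp
          push_cast
          ring
        rw [e]
        have : 0 ≤ ((n + 1 : ℕ) : ℝ) * (s - 1) + 1 / (s - 1) := by positivity
        linarith
    _ ≤ (1 + 1 / (s - 1)) * s ^ (n + 1) := mul_le_mul_of_nonneg_left h3 (by positivity)

end ShearForm

end Quadratic

end AffineMorphism

/-! ### Proportional leading forms -/

namespace AffineMorphism

open NumberField.HeightOneSpectrum

variable {K : Type*} [Field K]

/-- The coefficients of the two components of `f`. -/
def coeffs (f : AffineMorphism K) : Finset K := by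
  classical
  exact (f 0).support.image (f 0).coeff ∪ (f 1).support.image (f 1).coeff

theorem coeff_mem_coeffs (f : AffineMorphism K) (l : Fin 2) (s : Fin 2 →₀ ℕ) :
    (f l).coeff s = 0 ∨ (f l).coeff s ∈ f.coeffs := by
  classical
  by_cases h : (f l).coeff s = 0
  · exact Or.inl h
  · right
    have h' : s ∈ (f l).support := mem_support_iff.mpr h
    simp only [coeffs, Finset.mem_union, Finset.mem_image]
    rcases (by omega : l = 0 ∨ l = 1) with rfl | rfl
    · exact Or.inl ⟨s, h', rfl⟩
    · exact Or.inr ⟨s, h', rfl⟩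

variable [NumberField K]

theorem exists_adicAbv_eq_one (s : Finset K) :
    ∃ p : IsDedekindDomain.HeightOneSpectrum (𝓞 K), ∀ x ∈ s, x ≠ 0 → adicAbv K p x = 1 := by
  obtain ⟨n, hn, h⟩ := exists_adicAbv_eq_one_of_notMem s
  obtain ⟨p, hp⟩ := exists_heightOneSpectrum_notMem hn
  exact ⟨p, h K p hp⟩

variable {f : AffineMorphism K} {i j : Fin 2} {m : K}

/-- The point of slope `m`, to which the line at infinity is contracted, is not an indeterminacy
point. At a good prime its residue class is mapped into itself, so `Ξ = {m}`. -/
theorem hasLargeOrbitsOver_of_leadingForm_eq_of_eval_ne_zero (hδ : 1 < f.dynamicalDegree)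
    (hd : 2 ≤ f.degree) (hij : j ≠ i) (hF : f.leadingForm j = C m * f.leadingForm i)
    (hm : eval (slopeVec i m) (f.leadingForm i) ≠ 0) : f.HasLargeOrbitsOver K := by
  classical
  obtain ⟨p, hp⟩ := exists_adicAbv_eq_one
    (insert m (insert (eval (slopeVec i m) (f.leadingForm i)) f.coeffs))
  have hle : ∀ x : K, x = 0 ∨ adicAbv K p x = 1 → adicAbv K p x ≤ 1 := by
    rintro x (rfl | h)
    · rw [map_zero]; exact zero_le_one
    · exact h.le
  refine hasLargeOrbitsOver_of_residueRegion f hδ p hd (fun l s => hle _ ?_) hij (Ξ := {m}) ?_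
    (Set.singleton_nonempty m)
  · refine or_iff_not_imp_left.mpr fun h => ?_
    exact hp _ (by simp [(coeff_mem_coeffs f l s).resolve_left h]) h
  · rintro _ rfl
    refine ⟨hle _ (or_iff_not_imp_left.mpr fun h => hp _ (by simp) h), ?_, _, rfl, ?_⟩
    · exact hp _ (by simp) hm
    · rw [hF, map_mul, aeval_C, Algebra.algebraMap_self, RingHom.id_apply, sub_self, map_zero]
      exact zero_lt_one

/-- Since `δ > 1`, the coefficient `ρ` is nonzero, so `t` takes over the size of `x`. The rate is
the golden ratio if `α ≠ 0` and `√2` if `α = 0`; in both cases it is at least `δ`. -/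
theorem hasLargeOrbitsOver_of_leadingForm_eq_of_degree_eq_two (hδ : 1 < f.dynamicalDegree)
    (hd : f.degree = 2) (hij : j ≠ i) (hF : f.leadingForm j = C m * f.leadingForm i)
    (h0 : f.leadingForm i ≠ 0) (hm : eval (slopeVec i m) (f.leadingForm i) = 0) :
    f.HasLargeOrbitsOver K := by
  classical
  obtain ⟨α, β, a, b, c, ρ, q, r, hαβ, hfi, hfj⟩ := exists_shear_form hd hij hF h0 hm
  have hρ : ρ ≠ 0 := by
    rintro rfl
    exact absurd (dynamicalDegree_le_one_of_shear_form hij hfi hfj) hδ.not_ge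
  obtain ⟨p, hp⟩ := exists_adicAbv_eq_one {α, β, a, b, c, ρ, q, r}
  have hle : ∀ x ∈ ({α, β, a, b, c, ρ, q, r} : Finset K), adicAbv K p x ≤ 1 := fun x hx => by
    by_cases h : x = 0
    · rw [h, map_zero]; exact zero_le_one
    · exact (hp x hx h).le
  have hQi : ∀ P : Fin 2 → K, f.onPoints P i =
      shearCoord i j m P * (α * P i + β * shearCoord i j m P) +
      (a * P i + b * shearCoord i j m P + c) := fun P => by
    rw [onPoints, hfi]
    simp [shearCoord]
  have hQt : ∀ P : Fin 2 → K, shearCoord i j m (f.onPoints P) =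
      ρ * P i + q * shearCoord i j m P + r := fun P => by
    have e : shearCoord i j m (f.onPoints P) = aeval P (f j - C m * f i) := by
      simp [shearCoord, onPoints]
    rw [e, hfj]
    simp [shearCoord]
  have key : ∀ e : ℕ, e = 1 ∧ adicAbv K p α = 1 ∨ e = 0 ∧ α = 0 ∧ adicAbv K p β = 1 → ∀ s : ℝ,
      1 < s → s ^ 2 = e * s + (2 - e) → f.HasLargeOrbitsOver K := fun e he s hs hs2 => by
    refine hasLargeOrbitsOver_of_shearRegion f hδ p hij (m := m) (e := e) (by omega) hs hs2
      (dynamicalDegree_le_of_shear_form hij hfi hfj (by tauto) hs hs2) fun P hP => ?_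
    exact mem_shearRegion_of_form (isNonarchimedean_adicAbv K p) (hle β (by simp))
      (hle a (by simp)) (hle b (by simp)) (hle c (by simp)) (hp ρ (by simp) hρ) (hle q (by simp))
      (hle r (by simp)) he hP (hQi P) (hQt P)
  rcases hαβ with hα | ⟨hα, hβ⟩
  · refine key 1 (Or.inl ⟨rfl, hp α (by simp) hα⟩) _ Real.one_lt_goldenRatio ?_
    rw [Real.goldenRatio_sq]
    norm_num
  · refine key 0 (Or.inr ⟨rfl, hα, hp β (by simp) hβ⟩) _ Real.one_lt_sqrt_two ?_
    rw [Real.sq_sqrt zero_le_two]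
    norm_num

/-- Here the alternative between algebraic stability and degree two enters: contraction to an
indeterminacy point lowers the degree of `f ∘ f`, which stability forbids. -/
theorem hasLargeOrbitsOver_of_leadingForm_eq (hδ : 1 < f.dynamicalDegree)
    (hd : 2 ≤ f.degree) (hf : f.AlgebraicallyStable ∨ f.degree = 2) (hij : j ≠ i)
    (hF : f.leadingForm j = C m * f.leadingForm i) (h0 : f.leadingForm i ≠ 0) :
    f.HasLargeOrbitsOver K := by
  by_cases hm : eval (slopeVec i m) (f.leadingForm i) = 0
  · rcases hf with hf | hf
    · exact absurd hf.degree_comp_self (degree_comp_self_lt (by omega) hij hF hm).ne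
    · exact hasLargeOrbitsOver_of_leadingForm_eq_of_degree_eq_two hδ hf hij hF h0 hm
  · exact hasLargeOrbitsOver_of_leadingForm_eq_of_eval_ne_zero hδ hd hij hF hm

end AffineMorphism

/-! ### Points over finite fields on which a rational map acts as an inverse Frobenius -/

section FiniteField

/-- Divide by the gcd; if both quotients were constant, `a` and `b` would be proportional and all
minors would vanish. -/
theorem Polynomial.exists_isCoprime_mul_of_coeff_mul_sub_ne_zero {k : Type*} [Field k]
    {a b : Polynomial k} {s t : ℕ} (h : a.coeff s * b.coeff t - a.coeff t * b.coeff s ≠ 0) :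
    ∃ A B D : Polynomial k, a = A * D ∧ b = B * D ∧ IsCoprime A B ∧ D ≠ 0 ∧
      (0 < A.natDegree ∨ 0 < B.natDegree) := by
  classical
  have hb : b ≠ 0 := by
    rintro rfl
    simp at h
  set D := EuclideanDomain.gcd a b with hD
  have hD0 : D ≠ 0 := fun h0 => hb (EuclideanDomain.gcd_eq_zero_iff.mp h0).2
  obtain ⟨A, hA⟩ := EuclideanDomain.gcd_dvd_left a b
  obtain ⟨B, hB⟩ := EuclideanDomain.gcd_dvd_right a b
  rw [← hD, mul_comm] at hA hB
  refine ⟨A, B, D, hA, hB, ⟨EuclideanDomain.gcdA a b, EuclideanDomain.gcdB a b,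
    mul_right_cancel₀ hD0 ?_⟩, hD0, ?_⟩
  · have h1 : D = a * EuclideanDomain.gcdA a b + b * EuclideanDomain.gcdB a b :=
      EuclideanDomain.gcd_eq_gcd_ab a b
    linear_combination -h1 - hA * EuclideanDomain.gcdA a b - hB * EuclideanDomain.gcdB a b
  by_contra! hdeg
  obtain ⟨α, hα⟩ := Polynomial.natDegree_eq_zero.mp (Nat.le_zero.mp hdeg.1)
  obtain ⟨β, hβ⟩ := Polynomial.natDegree_eq_zero.mp (Nat.le_zero.mp hdeg.2)
  rw [hA, hB, ← hα, ← hβ] at h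
  simp only [Polynomial.coeff_C_mul] at h
  exact h (by ring)

variable {k : Type*} [Field k] [Fintype k]

/-- Frobenius of `k` fixes the coefficients of `g`. -/
theorem Polynomial.eval_map_pow_card_pow {k' : Type*} [Field k'] (σ : k →+* k')
    (g : Polynomial k) (e : ℕ) (x : k') :
    (g.map σ).eval x ^ Fintype.card k ^ e = (g.map σ).eval (x ^ Fintype.card k ^ e) := by
  induction e with
  | zero => simp
  | succ e ih =>
    rw [pow_succ, pow_mul, ih, pow_mul]
    generalize x ^ Fintype.card k ^ e = y
    rw [← Polynomial.eval_pow, ← Polynomial.map_pow, ← FiniteField.expand_card,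
      Polynomial.map_expand, Polynomial.expand_eval]

/-- The polynomial whose roots `ξ` satisfy `A(ξ) ^ Q = ξ B(ξ) ^ Q`, so that `A / B` maps `ξ` to its
`Q`-th root. -/
def frobeniusPoly {k : Type*} [Field k] (A B : Polynomial k) (Q : ℕ) : Polynomial k :=
  A ^ Q - Polynomial.X * B ^ Q

/-- As `Q = 0` in `k`, the derivative is `-B ^ Q`, which is coprime to `A ^ Q`. -/
theorem separable_frobeniusPoly {k : Type*} [Field k] {A B : Polynomial k} (hAB : IsCoprime A B)
    {Q : ℕ} (hQ : (Q : k) = 0) : (frobeniusPoly A B Q).Separable := by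
  have hder : Polynomial.derivative (frobeniusPoly A B Q) = -B ^ Q := by
    have h : ∀ g : Polynomial k, Polynomial.derivative (g ^ Q) = 0 := fun g => by
      rw [Polynomial.derivative_pow, hQ, map_zero, zero_mul, zero_mul]
    rw [frobeniusPoly, Polynomial.derivative_sub, Polynomial.derivative_mul, h, h,
      Polynomial.derivative_X]
    ring
  rw [Polynomial.Separable, hder, IsCoprime.neg_right_iff, frobeniusPoly, sub_eq_add_neg,
    ← neg_mul, mul_comm]
  exact IsCoprime.add_mul_left_left (hAB.pow (m := Q) (n := Q)) _

/-- The two terms have degrees congruent to `0` and to `1` modulo `Q` (when nonzero), so their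
leading terms cannot cancel. -/
theorem le_natDegree_frobeniusPoly {k : Type*} [Field k] {A B : Polynomial k}
    (hd : 0 < A.natDegree ∨ 0 < B.natDegree) {Q : ℕ} (hQ : 2 ≤ Q) :
    Q ≤ (frobeniusPoly A B Q).natDegree := by
  by_cases h : B.natDegree < A.natDegree
  · have h1 : (Polynomial.X * B ^ Q).natDegree ≤ 1 + Q * B.natDegree := by
      refine Polynomial.natDegree_mul_le.trans ?_
      rw [Polynomial.natDegree_X, Polynomial.natDegree_pow]
    have h2 : Q * B.natDegree + Q ≤ Q * A.natDegree := by
      calc Q * B.natDegree + Q = Q * (B.natDegree + 1) := by ring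
        _ ≤ _ := Nat.mul_le_mul_left _ h
    rw [frobeniusPoly, Polynomial.natDegree_sub_eq_left_of_natDegree_lt] <;>
      rw [Polynomial.natDegree_pow] <;> omega
  · have hB : 0 < B.natDegree := by omega
    have hB0 : B ≠ 0 := by
      rintro rfl
      simp at hB
    have h1 : (Polynomial.X * B ^ Q).natDegree = Q * B.natDegree + 1 := by
      rw [Polynomial.natDegree_X_mul (pow_ne_zero _ hB0), Polynomial.natDegree_pow]
    have h2 : Q * A.natDegree ≤ Q * B.natDegree := Nat.mul_le_mul_left _ (by omega)
    have h3 : Q ≤ Q * B.natDegree := Nat.le_mul_of_pos_right _ hB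
    rw [frobeniusPoly, Polynomial.natDegree_sub_eq_right_of_natDegree_lt] <;>
      rw [h1] <;> try rw [Polynomial.natDegree_pow]
    all_goals omega

/-- By separability there are at least `Q` distinct roots, more than `D` can have. -/
theorem exists_isRoot_frobeniusPoly {k k' : Type*} [Field k] [Field k'] (σ : k →+* k')
    {A B D : Polynomial k} (hAB : IsCoprime A B) (hD : D ≠ 0)
    (hd : 0 < A.natDegree ∨ 0 < B.natDegree) {Q : ℕ} (hQk : (Q : k) = 0) (hQ2 : 2 ≤ Q)
    (hQD : D.natDegree < Q) (hH : ((frobeniusPoly A B Q).map σ).Splits) :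
    ∃ ξ : k', ((frobeniusPoly A B Q).map σ).eval ξ = 0 ∧ (D.map σ).eval ξ ≠ 0 := by
  classical
  by_contra! h
  have hsep := (separable_frobeniusPoly hAB hQk).map (f := σ)
  have hH0 := hsep.ne_zero
  have hD0 : D.map σ ≠ 0 := Polynomial.map_ne_zero hD
  have h1 : ((frobeniusPoly A B Q).map σ).roots.toFinset ⊆ (D.map σ).roots.toFinset := by
    intro x hx
    rw [Multiset.mem_toFinset, Polynomial.mem_roots hD0]
    exact h x (Polynomial.isRoot_of_mem_roots (Multiset.mem_toFinset.mp hx))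
  have h2 := Finset.card_le_card h1
  rw [Multiset.toFinset_card_of_nodup (Polynomial.nodup_roots hsep),
    ← hH.natDegree_eq_card_roots, Polynomial.natDegree_map] at h2
  have h3 := (Multiset.toFinset_card_le _).trans (Polynomial.card_roots' (D.map σ))
  rw [Polynomial.natDegree_map] at h3
  have := le_natDegree_frobeniusPoly hd hQ2
  omega

/-- If `A(ξ) ^ Q = ξ B(ξ) ^ Q`, then `A / B` maps `ξ` to another such point. -/
theorem exists_eval_eq_mul_of_frobeniusPoly {k' : Type*} [Field k'] [Finite k'] (σ : k →+* k')
    {A B D : Polynomial k} (hAB : IsCoprime A B) {e : ℕ} {ξ : k'}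
    (hξ : ((frobeniusPoly A B (Fintype.card k ^ e)).map σ).eval ξ = 0)
    (hD : (D.map σ).eval ξ ≠ 0) :
    (B.map σ).eval ξ ≠ 0 ∧ ∃ η : k',
      ((frobeniusPoly A B (Fintype.card k ^ e)).map σ).eval η = 0 ∧ (D.map σ).eval η ≠ 0 ∧
      (A.map σ).eval ξ = η * (B.map σ).eval ξ := by
  obtain ⟨p, hp⟩ := CharP.exists k
  obtain ⟨n, hprime, hn⟩ := FiniteField.card k p
  have := Fact.mk hprime
  have : CharP k' p := (RingHom.charP_iff σ σ.injective p).mp hp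
  have hQ0 : Fintype.card k ^ e ≠ 0 := pow_ne_zero _ Fintype.card_ne_zero
  have hbij : Function.Bijective fun x : k' => x ^ Fintype.card k ^ e := by
    have := bijective_iterateFrobenius k' p (n * e)
    convert this using 2 with x
    rw [iterateFrobenius_def, hn, pow_mul]
  have hev : ∀ x : k', ((frobeniusPoly A B (Fintype.card k ^ e)).map σ).eval x =
      (A.map σ).eval x ^ Fintype.card k ^ e - x * (B.map σ).eval x ^ Fintype.card k ^ e :=
    fun x => by simp [frobeniusPoly]
  -- The image point is the `Q`-th root of `ξ`, which exists as finite fields are perfect. Raising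
  -- to the power `Q` carries `A`, `B` and `D` at `η` to their values at `ξ`, so `η` inherits both
  -- conditions.
  obtain ⟨η, hη⟩ := hbij.2 ξ
  have hη' : η ^ Fintype.card k ^ e = ξ := hη
  rw [hev, sub_eq_zero] at hξ
  have hAξ : (A.map σ).eval ξ = η * (B.map σ).eval ξ := by
    refine hbij.1 ?_
    simp only [mul_pow]
    rw [hξ, hη']
  refine ⟨fun h0 => ?_, η, ?_, fun h0 => ?_, hAξ⟩
  · obtain ⟨u, v, huv⟩ := hAB
    have h1 := congrArg (fun g => (g.map σ).eval ξ) huv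
    simp [hAξ, h0] at h1
  · rw [hev, Polynomial.eval_map_pow_card_pow, Polynomial.eval_map_pow_card_pow, hη', hAξ, sub_self]
  · refine hD ?_
    rw [← hη', ← Polynomial.eval_map_pow_card_pow, h0, zero_pow hQ0]

end FiniteField

/-! ### Lifting residue field extensions to number fields -/

section Splitting

theorem splits_ringOfIntegers_of_monic {K L : Type*} [Field K] [NumberField K] [Field L]
    [NumberField L] [Algebra K L] {g : Polynomial (𝓞 K)} (hg : g.Monic)
    (h : (g.map (algebraMap (𝓞 K) L)).Splits) : (g.map (algebraMap (𝓞 K) (𝓞 L))).Splits := by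
  have e : (g.map (algebraMap (𝓞 K) (𝓞 L))).map (algebraMap (𝓞 L) L) =
      g.map (algebraMap (𝓞 K) L) := by
    rw [Polynomial.map_map]
    rfl
  refine Polynomial.Splits.of_splits_map_of_injective (i := algebraMap (𝓞 L) L)
    (FaithfulSMul.algebraMap_injective (𝓞 L) L) (e ▸ h) fun x hx => ?_
  have hx0 := Polynomial.isRoot_of_mem_roots hx
  have hint : IsIntegral (𝓞 L) x := by
    refine ⟨g.map (algebraMap (𝓞 K) (𝓞 L)), hg.map _, ?_⟩
    rw [← Polynomial.eval_map]
    exact hx0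
  obtain ⟨y, hy⟩ := IsIntegrallyClosed.isIntegral_iff.mp hint
  exact ⟨y, hy⟩

/-- Lift a monic multiple of `H` to a monic polynomial over `𝓞 K` and adjoin its roots. These are
integral, so the factorization holds over `𝓞 L` and can be reduced modulo a prime above the given
one. -/
theorem exists_numberField_splits {K : Type u} [Field K] [NumberField K] {k : Type*} [Field k]
    {π : 𝓞 K →+* k} (hπ : Function.Surjective π) (hker : RingHom.ker π ≠ ⊥)
    {H : Polynomial k} (hH : H ≠ 0) :
    ∃ (L : Type u) (_ : Field L) (_ : NumberField L) (_ : Algebra K L)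
      (P : IsDedekindDomain.HeightOneSpectrum (𝓞 L)) (k' : Type u) (_ : Field k') (_ : Finite k')
      (π' : 𝓞 L →+* k') (σ : k →+* k'), Function.Surjective π' ∧ RingHom.ker π' = P.asIdeal ∧
      (∀ x, σ (π x) = π' (algebraMap (𝓞 K) (𝓞 L) x)) ∧ (H.map σ).Splits := by
  have hmonic : (Polynomial.C H.leadingCoeff⁻¹ * H).Monic := by
    rw [mul_comm]
    exact Polynomial.monic_mul_leadingCoeff_inv hH
  obtain ⟨g, hg, -, hgm⟩ := Polynomial.lifts_and_natDegree_eq_and_monic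
    (f := π) ((Polynomial.lifts_iff_coeff_lifts _).mpr fun n => hπ _) hmonic
  let G := g.map (algebraMap (𝓞 K) K)
  let L := G.SplittingField
  have : NumberField L := NumberField.of_module_finite K L
  have hsplit : (g.map (algebraMap (𝓞 K) (𝓞 L))).Splits := by
    refine splits_ringOfIntegers_of_monic hgm ?_
    have h := Polynomial.SplittingField.splits G
    rwa [Polynomial.map_map] at h
  have hmax : (RingHom.ker π).IsMaximal := RingHom.ker_isMaximal_of_surjective π hπ
  obtain ⟨P, hP, hPk⟩ := Ideal.exists_ideal_over_maximal_of_isIntegral (S := 𝓞 L)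
    (RingHom.ker π) (by
    rw [(RingHom.injective_iff_ker_eq_bot _).mp (FaithfulSMul.algebraMap_injective (𝓞 K) (𝓞 L))]
    exact bot_le)
  have hP0 : P ≠ ⊥ := by
    rintro rfl
    refine hker (hPk ▸ ?_)
    rw [← RingHom.ker_eq_comap_bot]
    exact (RingHom.injective_iff_ker_eq_bot _).mp (FaithfulSMul.algebraMap_injective (𝓞 K) (𝓞 L))
  let k' := 𝓞 L ⧸ P
  let fk' : Field k' := Ideal.Quotient.field P
  let π' : 𝓞 L →+* k' := Ideal.Quotient.mk P
  obtain ⟨σ, hσ⟩ : ∃ σ : k →+* k', ∀ x, σ (π x) = π' (algebraMap (𝓞 K) (𝓞 L) x) := by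
    have hle : RingHom.ker π ≤ RingHom.ker (π'.comp (algebraMap (𝓞 K) (𝓞 L))) := fun a ha => by
      rw [← hPk, Ideal.mem_comap] at ha
      exact Ideal.Quotient.eq_zero_iff_mem.mpr ha
    exact ⟨π.liftOfSurjective hπ ⟨_, hle⟩,
      π.liftOfRightInverse_comp_apply _ (Function.rightInverse_surjInv hπ) ⟨_, hle⟩⟩
  refine ⟨L, inferInstance, inferInstance, inferInstance, ⟨P, hP.isPrime, hP0⟩, k', fk',
    inferInstanceAs (Finite (𝓞 L ⧸ P)), π', σ, Ideal.Quotient.mk_surjective, Ideal.mk_ker, hσ, ?_⟩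
  have h1 : (H.map σ) = Polynomial.C (σ H.leadingCoeff) *
      (g.map (algebraMap (𝓞 K) (𝓞 L))).map π' := by
    have e : π'.comp (algebraMap (𝓞 K) (𝓞 L)) = σ.comp π := RingHom.ext fun x => (hσ x).symm
    rw [Polynomial.map_map, e, ← Polynomial.map_map, hg, Polynomial.map_mul, Polynomial.map_C,
      ← mul_assoc, ← Polynomial.C_mul, ← map_mul, mul_inv_cancel₀ (by simpa using hH), map_one,
      Polynomial.C_1, one_mul]
  rw [h1]
  exact (hsplit.map π').C_mul _

end Splitting

namespace AffineMorphism

/-! ### Dehomogenized leading forms -/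

section LeadingForm

open NumberField.HeightOneSpectrum

variable {K : Type*} [Field K]

/-- The dehomogenization `F(T, 1)` of a form `F`, in the chart where the `i`-th coordinate
is `1`. -/
def dehomogenization (i : Fin 2) (F : MvPolynomial (Fin 2) K) : Polynomial K :=
  aeval (fun l => if l = i then 1 else Polynomial.X) F

theorem aeval_dehomogenization {L : Type*} [Field L] [Algebra K L] (i : Fin 2)
    (F : MvPolynomial (Fin 2) K) (ξ : L) :
    Polynomial.aeval ξ (dehomogenization i F) = aeval (slopeVec i ξ) F := by
  rw [dehomogenization, comp_aeval_apply]
  congr 2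
  ext l
  by_cases h : l = i <;> simp [slopeVec, h]

/-- By homogeneity `F` vanishes wherever the `i`-th coordinate does not, so `X i * F` vanishes at
all points. -/
theorem eq_zero_of_dehomogenization_eq_zero [Infinite K] {i : Fin 2} {F : MvPolynomial (Fin 2) K}
    {d : ℕ} (hF : F.IsHomogeneous d) (h : dehomogenization i F = 0) : F = 0 := by
  have h1 : X i * F = 0 := by
    refine MvPolynomial.funext fun P => ?_
    rw [map_mul, eval_X, map_zero, mul_eq_zero]
    refine or_iff_not_imp_left.mpr fun hP => ?_
    have h2 := congrArg (eval (0 : Fin 2 → K))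
      (bind₁_smul_of_isHomogeneous hF (slopeVec i (P (1 - i) / P i))
        (C (P i) : MvPolynomial (Fin 2) K))
    have h3 : eval (slopeVec i (P (1 - i) / P i)) F = 0 := by
      have := aeval_dehomogenization i F (P (1 - i) / P i)
      rw [h, map_zero] at this
      exact this.symm
    rw [h3, map_zero, zero_mul, map_zero] at h2
    have e : (fun l => C (slopeVec i (P (1 - i) / P i) l) * C (P i)) =
        fun l => (C (P l) : MvPolynomial (Fin 2) K) := by
      ext1 l
      rw [← C_mul]
      by_cases hl : l = i
      · rw [hl, slopeVec_self, one_mul]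
      · rw [slopeVec_of_ne hl, div_mul_cancel₀ _ hP, show l = 1 - i by omega]
    rw [e] at h2
    have h4 : bind₁ (fun l => C (P l)) F = (C (eval P F) : MvPolynomial (Fin 2) K) :=
      aeval_algebraMap_apply _ P F
    rwa [h4, eval_C] at h2
  exact (mul_eq_zero.mp h1).resolve_left (X_ne_zero i)

/-- Either one of the leading forms is a multiple of the other, or their dehomogenizations are
linearly independent, as witnessed by a minor of their coefficients. -/
theorem leadingForm_eq_or_exists_coeff_ne_zero [Infinite K] (f : AffineMorphism K)
    (h0 : ∃ i, f.leadingForm i ≠ 0) (i₀ : Fin 2) :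
    (∃ i j : Fin 2, j ≠ i ∧ ∃ m, f.leadingForm j = C m * f.leadingForm i ∧ f.leadingForm i ≠ 0) ∨
    ∃ s t : ℕ, (dehomogenization i₀ (f.leadingForm 0)).coeff s *
      (dehomogenization i₀ (f.leadingForm 1)).coeff t -
      (dehomogenization i₀ (f.leadingForm 0)).coeff t *
      (dehomogenization i₀ (f.leadingForm 1)).coeff s ≠ 0 := by
  refine or_iff_not_imp_right.mpr fun hst => ?_
  push Not at hst
  have hhom : ∀ l, (f.leadingForm l).IsHomogeneous f.degree := fun l =>
    homogeneousComponent_isHomogeneous _ _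
  by_cases h1 : f.leadingForm 1 = 0
  · obtain ⟨i, hi⟩ := h0
    have hi0 : i = 0 := by
      by_contra hne
      rw [show i = 1 by omega] at hi
      exact hi h1
    subst hi0
    exact ⟨0, 1, one_ne_zero, 0, by rw [h1, map_zero, zero_mul], hi⟩
  · set a := dehomogenization i₀ (f.leadingForm 0) with ha
    set b := dehomogenization i₀ (f.leadingForm 1) with hb
    have hb0 : b ≠ 0 := fun h => h1 (eq_zero_of_dehomogenization_eq_zero (hhom 1) h)
    obtain ⟨t, ht⟩ : ∃ t, b.coeff t ≠ 0 := by
      by_contra! h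
      exact hb0 (Polynomial.ext h)
    refine ⟨1, 0, zero_ne_one, a.coeff t / b.coeff t, ?_, h1⟩
    rw [← sub_eq_zero]
    refine eq_zero_of_dehomogenization_eq_zero (i := i₀) ((hhom 0).sub ((hhom 1).C_mul _)) ?_
    have e : dehomogenization i₀ (f.leadingForm 0 - C (a.coeff t / b.coeff t) * f.leadingForm 1) =
        a - Polynomial.C (a.coeff t / b.coeff t) * b := by
      simp [dehomogenization, ha, hb, Polynomial.algebraMap_eq]
    rw [e]
    ext s
    rw [Polynomial.coeff_sub, Polynomial.coeff_C_mul, Polynomial.coeff_zero]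
    field_simp
    linear_combination hst s t

end LeadingForm

end AffineMorphism

/-! ### Integral models and reduction -/

section Integral

theorem exists_map_eq_C_mul {K : Type*} [Field K] [NumberField K] (a b : Polynomial K) :
    ∃ (N : 𝓞 K) (a' b' : Polynomial (𝓞 K)), N ≠ 0 ∧
      a'.map (algebraMap (𝓞 K) K) = Polynomial.C (algebraMap (𝓞 K) K N) * a ∧
      b'.map (algebraMap (𝓞 K) K) = Polynomial.C (algebraMap (𝓞 K) K N) * b := by
  obtain ⟨u, hu, ha⟩ := IsLocalization.integerNormalization_spec (nonZeroDivisors (𝓞 K)) a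
  obtain ⟨v, hv, hb⟩ := IsLocalization.integerNormalization_spec (nonZeroDivisors (𝓞 K)) b
  have hsmul (n : 𝓞 K) (g : Polynomial K) :
      n • g = Polynomial.C (algebraMap (𝓞 K) K n) * g := by
    ext m
    rw [Polynomial.coeff_C_mul, ← Algebra.smul_def]
    rfl
  refine ⟨u * v, Polynomial.C v * IsLocalization.integerNormalization (nonZeroDivisors (𝓞 K)) a,
    Polynomial.C u * IsLocalization.integerNormalization (nonZeroDivisors (𝓞 K)) b,
    mul_ne_zero (nonZeroDivisors.ne_zero hu) (nonZeroDivisors.ne_zero hv), ?_, ?_⟩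
  · rw [Polynomial.map_mul, Polynomial.map_C, ha.trans (hsmul u a), map_mul, map_mul]
    ring
  · rw [Polynomial.map_mul, Polynomial.map_C, hb.trans (hsmul v b), map_mul, map_mul]
    ring

theorem exists_finite_residueField {K : Type u} [Field K] [NumberField K]
    (p : IsDedekindDomain.HeightOneSpectrum (𝓞 K)) :
    ∃ (k : Type u) (_ : Field k) (_ : Fintype k) (π : 𝓞 K →+* k), Function.Surjective π ∧
      RingHom.ker π = p.asIdeal :=
  ⟨𝓞 K ⧸ p.asIdeal, Ideal.Quotient.field p.asIdeal, Fintype.ofFinite (𝓞 K ⧸ p.asIdeal),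
    Ideal.Quotient.mk p.asIdeal, Ideal.Quotient.mk_surjective, Ideal.mk_ker⟩

theorem apply_aeval_eq_eval_map_map {R S k k' : Type*} [CommRing R] [CommRing S] [Algebra R S]
    [Field k] [Field k'] {π : R →+* k} {π' : S →+* k'} {σ : k →+* k'}
    (hσ : ∀ x, σ (π x) = π' (algebraMap R S x)) (g : Polynomial R) (x : S) :
    π' (Polynomial.aeval x g) = ((g.map π).map σ).eval (π' x) := by
  have e : σ.comp π = π'.comp (algebraMap R S) := RingHom.ext hσ
  rw [Polynomial.map_map, e, ← Polynomial.map_map, Polynomial.eval_map_apply,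
    Polynomial.eval_map_algebraMap]

variable {L : Type*} [Field L] [NumberField L] (P : IsDedekindDomain.HeightOneSpectrum (𝓞 L))

open NumberField.HeightOneSpectrum

theorem adicAbv_algebraMap_le_one (x : 𝓞 L) : adicAbv L P (algebraMap (𝓞 L) L x) ≤ 1 := by
  rw [← FinitePlace.norm_embedding]
  exact FinitePlace.norm_le_one L P x

theorem adicAbv_algebraMap_eq_one {x : 𝓞 L} (hx : x ∉ P.asIdeal) :
    adicAbv L P (algebraMap (𝓞 L) L x) = 1 := by
  rw [← FinitePlace.norm_embedding]
  exact (FinitePlace.norm_eq_one_iff_notMem L P x).mpr hx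

theorem adicAbv_algebraMap_lt_one {x : 𝓞 L} (hx : x ∈ P.asIdeal) :
    adicAbv L P (algebraMap (𝓞 L) L x) < 1 := by
  rw [← FinitePlace.norm_embedding]
  exact (FinitePlace.norm_lt_one_iff_mem L P x).mpr hx

theorem algebraMap_ringOfIntegers_apply {K L : Type*} [Field K] [NumberField K] [Field L]
    [NumberField L] [Algebra K L] (x : 𝓞 K) :
    algebraMap (𝓞 L) L (algebraMap (𝓞 K) (𝓞 L) x) = algebraMap K L (algebraMap (𝓞 K) K x) :=
  rfl

end Integral

/-! ### Linearly independent leading forms -/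

namespace AffineMorphism

open NumberField.HeightOneSpectrum

theorem algebraMap_aeval_eq {K L : Type*} [Field K] [NumberField K] [Field L] [NumberField L]
    [Algebra K L] {N : 𝓞 K} {g : Polynomial (𝓞 K)} {i : Fin 2} {F : MvPolynomial (Fin 2) K}
    (hg : g.map (algebraMap (𝓞 K) K) =
      Polynomial.C (algebraMap (𝓞 K) K N) * dehomogenization i F) (x : 𝓞 L) :
    algebraMap (𝓞 L) L (Polynomial.aeval x g) =
      algebraMap K L (algebraMap (𝓞 K) K N) * aeval (slopeVec i (algebraMap (𝓞 L) L x)) F := by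
  have h := congrArg (Polynomial.aeval (algebraMap (𝓞 L) L x)) hg
  rwa [map_mul, Polynomial.aeval_C, aeval_dehomogenization, Polynomial.aeval_map_algebraMap,
    Polynomial.aeval_algebraMap_apply] at h

theorem exists_hasLargeOrbitsOver_of_coeff_ne_zero {K : Type u} [Field K] [NumberField K]
    {f : AffineMorphism K}
    (hδ : 1 < f.dynamicalDegree) (hd : 2 ≤ f.degree) {s t : ℕ}
    (hst : (dehomogenization 1 (f.leadingForm 0)).coeff s *
      (dehomogenization 1 (f.leadingForm 1)).coeff t -
      (dehomogenization 1 (f.leadingForm 0)).coeff t *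
      (dehomogenization 1 (f.leadingForm 1)).coeff s ≠ 0) :
    ∃ (L : Type u) (_ : Field L) (_ : NumberField L) (_ : Algebra K L),
      f.HasLargeOrbitsOver L := by
  obtain ⟨N, a, b, hN, ha, hb⟩ := exists_map_eq_C_mul (dehomogenization 1 (f.leadingForm 0))
    (dehomogenization 1 (f.leadingForm 1))
  have hac : ∀ m, algebraMap (𝓞 K) K (a.coeff m) =
      algebraMap (𝓞 K) K N * (dehomogenization 1 (f.leadingForm 0)).coeff m := fun m => by
    rw [← Polynomial.coeff_C_mul, ← ha, Polynomial.coeff_map]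
  have hbc : ∀ m, algebraMap (𝓞 K) K (b.coeff m) =
      algebraMap (𝓞 K) K N * (dehomogenization 1 (f.leadingForm 1)).coeff m := fun m => by
    rw [← Polynomial.coeff_C_mul, ← hb, Polynomial.coeff_map]
  have hminor : a.coeff s * b.coeff t - a.coeff t * b.coeff s ≠ 0 := fun h => by
    have h1 := congrArg (algebraMap (𝓞 K) K) h
    rw [map_sub, map_mul, map_mul, hac, hbc, hac, hbc, map_zero] at h1
    have hN' : algebraMap (𝓞 K) K N ≠ 0 := by simpa using hN
    refine mul_ne_zero (pow_ne_zero 2 hN') hst ?_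
    linear_combination h1
  obtain ⟨n, hn, hgood⟩ := exists_adicAbv_eq_one_of_notMem.{u, u} f.coeffs
  -- Avoiding `n` makes the coefficients of `f` integral, avoiding `N` makes the cleared denominator
  -- a unit, and avoiding the minor keeps the reduced forms independent.
  obtain ⟨p, hp⟩ := exists_heightOneSpectrum_notMem (mul_ne_zero (mul_ne_zero hn hN) hminor)
  obtain ⟨k, _, _, π, hsurj, hker⟩ := exists_finite_residueField p
  have hπ : ∀ x, π x = 0 ↔ x ∈ p.asIdeal := fun x => by rw [← hker, RingHom.mem_ker]
  rw [← hπ, map_mul, map_mul, mul_eq_zero, mul_eq_zero, not_or, not_or] at hp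
  obtain ⟨⟨hn1, hN1⟩, hm1⟩ := hp
  obtain ⟨A, B, D, hA, hB, hAB, hD, hdeg⟩ :=
    Polynomial.exists_isCoprime_mul_of_coeff_mul_sub_ne_zero (a := a.map π) (b := b.map π)
      (s := s) (t := t) (by simpa only [Polynomial.coeff_map, ← map_mul, ← map_sub] using hm1)
  -- This choice gives `Q = |k| ^ e > e > deg D`, as the root count requires.
  set e := D.natDegree + 1 with he
  have hQk : ((Fintype.card k ^ e : ℕ) : k) = 0 := by
    rw [Nat.cast_pow, FiniteField.cast_card_eq_zero, zero_pow (Nat.succ_ne_zero _)]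
  have hQD : e < Fintype.card k ^ e := Nat.lt_pow_self Fintype.one_lt_card
  obtain ⟨L, _, _, _, P, k', _, _, π', σ, hπ', hkerP, hσ, hsplit⟩ :=
    exists_numberField_splits hsurj (by rw [hker]; exact p.ne_bot)
      (separable_frobeniusPoly hAB hQk).ne_zero
  obtain ⟨ξ₀, hξ₀, hDξ₀⟩ := exists_isRoot_frobeniusPoly σ hAB hD hdeg hQk (by omega)
    (by omega) hsplit
  have hP0 : ∀ x : 𝓞 L, π' x = 0 ↔ x ∈ P.asIdeal := fun x => by rw [← hkerP, RingHom.mem_ker]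
  have hP1 : ∀ x : 𝓞 K, π x ≠ 0 → algebraMap (𝓞 K) (𝓞 L) x ∉ P.asIdeal := fun x hx h => by
    rw [← hP0, ← hσ] at h
    exact hx ((map_eq_zero σ).mp h)
  have w_eq : ∀ x : 𝓞 L, x ∉ P.asIdeal → adicAbv L P (algebraMap (𝓞 L) L x) = 1 :=
    fun x hx => adicAbv_algebraMap_eq_one P hx
  have hNL : adicAbv L P (algebraMap K L (algebraMap (𝓞 K) K N)) = 1 := by
    rw [← algebraMap_ringOfIntegers_apply]
    exact w_eq _ (hP1 N hN1)
  have hval := fun g F hg => algebraMap_aeval_eq (L := L) (N := N) (g := g) (i := 1) (F := F) hg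
  have hred := apply_aeval_eq_eval_map_map hσ
  refine ⟨L, inferInstance, inferInstance, inferInstance, ?_⟩
  refine hasLargeOrbitsOver_of_residueRegion f hδ P hd (fun l m => ?_) zero_ne_one
    -- All integral lifts of the good points of the residue field; `A / B` permits no escape from
    -- this set, so no periodic cycle has to be singled out.
    (Ξ := {ξ | ∃ x : 𝓞 L, algebraMap (𝓞 L) L x = ξ ∧
      ((frobeniusPoly A B (Fintype.card k ^ e)).map σ).eval (π' x) = 0 ∧
      (D.map σ).eval (π' x) ≠ 0}) ?_ ?_
  · rcases coeff_mem_coeffs f l m with h | h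
    · rw [h, map_zero, map_zero]
      exact zero_le_one
    · by_cases h0 : (f l).coeff m = 0
      · rw [h0, map_zero, map_zero]
        exact zero_le_one
      · exact (hgood L P (hP1 n hn1) _ h h0).le
  · rintro _ ⟨x, rfl, hx, hDx⟩
    obtain ⟨hBx, η, hη, hDη, hAη⟩ := exists_eval_eq_mul_of_frobeniusPoly σ hAB hx hDx
    obtain ⟨y, rfl⟩ := hπ' η
    refine ⟨adicAbv_algebraMap_le_one P x, ?_, algebraMap (𝓞 L) L y, ⟨y, rfl, hη, hDη⟩, ?_⟩
    · have h1 := w_eq (Polynomial.aeval x b) (by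
        rw [← hP0, hred, hB, Polynomial.map_mul, Polynomial.eval_mul]
        exact mul_ne_zero hBx hDx)
      rwa [hval b _ hb, map_mul, hNL, one_mul] at h1
    · have h1 := adicAbv_algebraMap_lt_one P
        (x := Polynomial.aeval x a - y * Polynomial.aeval x b) (by
        rw [← hP0, map_sub, map_mul, hred, hred, hA, hB, Polynomial.map_mul, Polynomial.map_mul,
          Polynomial.eval_mul, Polynomial.eval_mul, hAη]
        ring)
      rw [map_sub, map_mul, hval a _ ha, hval b _ hb, mul_left_comm, ← mul_sub, map_mul, hNL,
        one_mul] at h1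
      exact h1
  · obtain ⟨x, rfl⟩ := hπ' ξ₀
    exact ⟨algebraMap (𝓞 L) L x, x, rfl, hξ₀, hDξ₀⟩

variable {K : Type*} [Field K]

theorem degree_ne_zero_of_one_lt_dynamicalDegree {f : AffineMorphism K}
    (hδ : 1 < f.dynamicalDegree) : f.degree ≠ 0 := fun h => by
  refine hδ.not_ge (dynamicalDegree_le_of_degree_le f one_pos one_pos fun n => ?_)
  have h1 := degree_iterate_le f n
  rw [h, zero_pow (Nat.succ_ne_zero n)] at h1
  rw [Nat.le_zero.mp h1]
  simp

theorem two_le_degree_of_one_lt_dynamicalDegree {f : AffineMorphism K}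
    (hδ : 1 < f.dynamicalDegree) : 2 ≤ f.degree := by
  have h1 := degree_ne_zero_of_one_lt_dynamicalDegree hδ
  have h2 : (1 : ℝ) < f.degree := hδ.trans_le (dynamicalDegree_le_degree f (by omega))
  exact_mod_cast h2

theorem exists_leadingForm_ne_zero {f : AffineMorphism K} (hd : f.degree ≠ 0) :
    ∃ i, f.leadingForm i ≠ 0 := by
  by_contra! h
  have h1 : ∀ l, (f l).totalDegree < f.degree := fun l => by
    rcases homogeneousComponent_sub_leadingForm f l with h2 | h2 <;> rw [h, sub_zero] at h2
    · rw [h2, totalDegree_zero]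
      omega
    · exact h2
  exact lt_irrefl f.degree (max_lt (h1 0) (h1 1))

end AffineMorphism

end

theorem theorem16 {K : Type u} [Field K] [NumberField K] (f : AffineMorphism K)
    (hdom : f.Dominant) (hδ : 1 < f.dynamicalDegree)
    (hf : f.AlgebraicallyStable ∨ f.degree = 2) :
    ∃ (K' : Type u) (_ : Field K') (_ : NumberField K') (_ : Algebra K K')
      (_ : FiniteDimensional K K'),
      (∃ (p : IsDedekindDomain.HeightOneSpectrum (𝓞 K'))
        (U : Set (ℙ (p.adicCompletion K') (Fin 3 → p.adicCompletion K'))),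
        IsOpen U ∧ U.Nonempty ∧
        ∀ P : Fin 2 → K',
          AffineMorphism.toProj (fun i => algebraMap K' (p.adicCompletion K') (P i)) ∈ U →
            0 < f.weakLowerCanonicalHeight P) ∧
      ∃ S : Set (Fin 2 → K'),
        AffineMorphism.ZariskiDense S ∧
        S.PairwiseDisjoint (fun P => f.orbit P) ∧
        ∀ P ∈ S, f.HasArithmeticDegree P f.dynamicalDegree := by
  have hd := AffineMorphism.two_le_degree_of_one_lt_dynamicalDegree hδ
  -- Either `f` contracts the line at infinity, and no extension of `K` is needed, or it induces a
  -- nonconstant map on it.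
  rcases AffineMorphism.leadingForm_eq_or_exists_coeff_ne_zero f
    (AffineMorphism.exists_leadingForm_ne_zero (by omega)) 1 with
    ⟨i, j, hij, m, hF, h0⟩ | ⟨s, t, hst⟩
  · exact ⟨K, inferInstance, inferInstance, inferInstance, inferInstance,
      AffineMorphism.hasLargeOrbitsOver_of_leadingForm_eq hδ hd hf hij hF h0⟩
  · obtain ⟨L, _, _, _, hL⟩ := AffineMorphism.exists_hasLargeOrbitsOver_of_coeff_ne_zero hδ hd hst
    exact ⟨L, inferInstance, inferInstance, inferInstance, inferInstance, hL⟩
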